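/- Conventions. For a finite set $V$, let $V^{(3)}$ be the family of all $3$-element subsets of $V$. A $3$-graph $G$ consists of a finite vertex set $V(G)$ and an edge set $E(G)\subseteq V(G)^{(3)}$; $H$ is a subgraph of $G$ if $V(H)\subseteq V(G)$ and $E(H)\subseteq E(G)$. Write $[n]=\{1,\dots,n\}$, and let $[n]^{(3)}$ also denote the complete $3$-graph on the vertex set $[n]$. A clique of order $t$ in $G$ is a subgraph of $G$ of the form $(T,T^{(3)})$ with $|T|=t$. The Lagrangian of $G$ is $$\lambda(G)=\max\Big\{\sum_{\{i,j,k\}\in E(G)}x_ix_jx_k \;:\; x_v\ge 0 \text{ for all } v\in V(G),\ \sum_{v\in V(G)}x_v=1\Big\}.$$ A $3$-graph $G$ with vertex set $[n]$ is left-compressed if, whenever $j_1<j_2<j_3$ form an edge of $G$ and $i_1<i_2<i_3$ are elements of $[n]$ with $i_p\le j_p$ for $p=1,2,3$, then $\{i_1,i_2,i_3\}$ is also an edge of $G$. Theorem 1.9. Let $l$ be a positive integer. Suppose that $\lambda(G)<\lambda([l-1]^{(3)})$ holds for every left-compressed $3$-graph $G$ on the vertex set $[l]$ that has exactly $\binom{l-1}{3}+\binom{l-2}{2}$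 edges and does not contain $[l-1]^{(3)}$ as a subgraph. Then for every positive integer $m$ with $$\binom{l-1}{3}\le m\le\binom{l-1}{3}+\binom{l-2}{2}$$ and every $3$-graph $G$ with $m$ edges that contains no clique of order $l-1$, one has $\lambda(G)<\lambda([l-1]^{(3)})$. -/

import Mathlib

universe u

/-- An `r`-uniform graph with a finite vertex set `verts` (of elements of `α`) and an edge set
consisting of `r`-element subsets of the vertex set. -/
structure RGraph (r : ℕ) (α : Type u) where
  verts : Finset α
  edges : Finset (Finset α)
  edges_sub : edges ⊆ verts.powersetCard r

namespace RGraph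

variable {r : ℕ} {α : Type u}

/-- `H` is a subgraph of `G`. -/
def IsSubgraph (H G : RGraph r α) : Prop :=
  H.verts ⊆ G.verts ∧ H.edges ⊆ G.edges

/-- The complete `r`-graph `V^(r)` on the vertex set `V`. -/
def complete (r : ℕ) (V : Finset α) : RGraph r α where
  verts := V
  edges := V.powersetCard r
  edges_sub := Finset.Subset.refl _

/-- The complete `r`-graph `[n]^(r)` on the vertex set `[n] = {1, …, n}`. -/
def initial (r n : ℕ) : RGraph r ℕ :=
  complete r (Finset.Icc 1 n)

/-- `G` contains a clique of order `t`: a complete `r`-graph on `t` vertices as a subgraph. -/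
def HasClique (G : RGraph r α) (t : ℕ) : Prop :=
  ∃ V : Finset α, V.card = t ∧ (complete r V).IsSubgraph G

/-- The polynomial `λ(G, x)`: the sum over the edges of the products of the weights. -/
def weightPoly (G : RGraph r α) (x : α → ℝ) : ℝ :=
  ∑ e ∈ G.edges, ∏ i ∈ e, x i

/-- The legal weightings of `G`: non-negative on the vertices, of total weight `1`.
(The values of `x` off the vertex set play no role.) -/
def weightings (G : RGraph r α) : Set (α → ℝ) :=
  {x | (∀ i ∈ G.verts, 0 ≤ x i) ∧ ∑ i ∈ G.verts, x i = 1}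

/-- The Lagrangian `λ(G)`: the maximum of `λ(G, x)` over the legal weightings. The supremum is
attained, by compactness of the simplex, as soon as `G` has a vertex. -/
noncomputable def lagrangian (G : RGraph r α) : ℝ :=
  sSup (G.weightPoly '' G.weightings)

/-- An `r`-graph of positive integers is left-compressed if `j₁ < ⋯ < jᵣ` being an edge implies
that `i₁ < ⋯ < iᵣ` is an edge, for all vertices `i₁, …, iᵣ` with `iₚ ≤ jₚ` for every `p`. -/
def LeftCompressed (G : RGraph r ℕ) : Prop :=
  ∀ i j : Fin r → ℕ, StrictMono i → StrictMono j → (∀ p, i p ∈ G.verts) → (∀ p, i p ≤ j p) →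
    Finset.univ.image j ∈ G.edges → Finset.univ.image i ∈ G.edges

end RGraph

/-! Put M = C(l-1,3) + C(l-2,2) and maximise the polynomial over all families of at most M triples
and all weightings at once. The core is `IsExtremal.clique_of_le`: if this maximum reaches
λ([l-1]^(3)), it equals it, and an optimal family with a pair-covering optimal weighting contains a
clique of order l-1. For an arbitrary optimal pair this bounds the maximum; a clique-free family
attaining the bound would itself be optimal, hence contain the clique (`wt_lt_of_no_clique`).

Optimality makes the partial derivatives agree on the support, and weight can be moved until any two
support vertices share an edge. The support then has k ≥ l-1 vertices (`le_card_support`), and for k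
= l-1 all its triples must be present. For k ≥ l, order the vertices by decreasing weight, with o
the heaviest and u, v the two lightest; the family can be left-compressed while keeping some edge
through u and v (`exists_shifted_pair`).

If k > l, `choose_le_card` yields at least C(k-1,3) ≥ C(l,3) > M edges: with fewer, giving the
weight of v to u and replacing the edges at v by missing triples would gain more than the
second-order loss. If k = l, there are exactly M edges. Either the hypothesis of the theorem
applies, or the first l-1 vertices span a clique, which `false_of_clique` excludes by comparing the
links of u and v. -/

set_option linter.unusedSectionVars false

namespace TripleSystem

open Finset

/-! ### The Lagrangian polynomial, its derivatives and weight shifts. -/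

section Weights

variable {V : Type*} [DecidableEq V]

/-- The Lagrangian polynomial of a family of sets. -/
def wt (E : Finset (Finset V)) (x : V → ℝ) : ℝ := ∑ e ∈ E, ∏ i ∈ e, x i

/-- The partial derivative of `wt E` in the direction of the vertex `a`. -/
def linkWt (E : Finset (Finset V)) (x : V → ℝ) (a : V) : ℝ :=
  ∑ e ∈ E with a ∈ e, ∏ i ∈ e.erase a, x i

/-- The mixed second partial derivative of `wt E`. -/
def pairWt (E : Finset (Finset V)) (x : V → ℝ) (a b : V) : ℝ :=
  ∑ e ∈ E with a ∈ e ∧ b ∈ e, ∏ i ∈ (e.erase a).erase b, x i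

/-- Move the weight `t` from `b` to `a`. -/
def shift (x : V → ℝ) (a b : V) (t : ℝ) : V → ℝ :=
  fun i => if i = a then x a + t else if i = b then x b - t else x i

/-- The set obtained from `e` by replacing `a` with `b`. -/
def swap (a b : V) (e : Finset V) : Finset V := insert b (e.erase a)

/-- The contribution of the edges at `a` (not containing `b`) that cannot be moved to `b`. -/
def excessWt (E : Finset (Finset V)) (x : V → ℝ) (a b : V) : ℝ :=
  ∑ e ∈ E with a ∈ e ∧ b ∉ e ∧ swap a b e ∉ E, ∏ i ∈ e.erase a, x i

lemma shift_left (x : V → ℝ) (a b : V) (t : ℝ) : shift x a b t a = x a + t := by simp [shift]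

lemma shift_right {a b : V} (x : V → ℝ) (h : a ≠ b) (t : ℝ) : shift x a b t b = x b - t := by
  simp [shift, h.symm]

lemma shift_of_ne {a b i : V} (x : V → ℝ) (ha : i ≠ a) (hb : i ≠ b) (t : ℝ) :
    shift x a b t i = x i := by simp [shift, ha, hb]

lemma prod_shift_of_notMem {a b : V} (x : V → ℝ) (t : ℝ) {e : Finset V} (ha : a ∉ e)
    (hb : b ∉ e) : ∏ i ∈ e, shift x a b t i = ∏ i ∈ e, x i :=
  prod_congr rfl fun _ hi => shift_of_ne x (ne_of_mem_of_not_mem hi ha) (ne_of_mem_of_not_mem hi hb) t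

lemma prod_shift {a b : V} (hab : a ≠ b) (x : V → ℝ) (t : ℝ) (e : Finset V) :
    ∏ i ∈ e, shift x a b t i = ∏ i ∈ e, x i
      + t * ((if a ∈ e then ∏ i ∈ e.erase a, x i else 0)
        - (if b ∈ e then ∏ i ∈ e.erase b, x i else 0))
      - t ^ 2 * (if a ∈ e ∧ b ∈ e then ∏ i ∈ (e.erase a).erase b, x i else 0) := by
  by_cases ha : a ∈ e <;> by_cases hb : b ∈ e
  · have hb' : b ∈ e.erase a := mem_erase.2 ⟨hab.symm, hb⟩
    have ha' : a ∈ e.erase b := mem_erase.2 ⟨hab, ha⟩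
    rw [← mul_prod_erase e (shift x a b t) ha, ← mul_prod_erase _ (shift x a b t) hb',
      ← mul_prod_erase e x ha, ← mul_prod_erase (e.erase a) x hb', ← mul_prod_erase (e.erase b) x ha',
      shift_left, shift_right x hab, prod_shift_of_notMem x t (by simp) (by simp),
      erase_right_comm (a := b) (b := a)]
    simp only [ha, hb, and_self, if_true]
    ring
  · rw [← mul_prod_erase e (shift x a b t) ha, ← mul_prod_erase e x ha, shift_left,
      prod_shift_of_notMem x t (by simp) (by simp [hb])]
    simp only [ha, hb, and_false, if_true, if_false]
    ring
  · rw [← mul_prod_erase e (shift x a b t) hb, ← mul_prod_erase e x hb, shift_right x hab,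
      prod_shift_of_notMem x t (by simp [ha]) (by simp)]
    simp only [ha, hb, false_and, if_true, if_false]
    ring
  · rw [prod_shift_of_notMem x t ha hb]
    simp [ha, hb]

/-- Every monomial is multilinear, so along the direction from `b` to `a` the polynomial is
quadratic and this expansion is exact. -/
lemma wt_shift {a b : V} (hab : a ≠ b) (E : Finset (Finset V)) (x : V → ℝ) (t : ℝ) :
    wt E (shift x a b t) = wt E x + t * (linkWt E x a - linkWt E x b) - t ^ 2 * pairWt E x a b := by
  simp only [wt, linkWt, pairWt, sum_filter, prod_shift hab, sum_add_distrib, sum_sub_distrib,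
    ← mul_sum]

lemma pairWt_comm (E : Finset (Finset V)) (x : V → ℝ) (a b : V) :
    pairWt E x a b = pairWt E x b a := by
  unfold pairWt
  refine sum_congr (by ext; simp [and_comm]) fun e _ => by rw [erase_right_comm]

lemma swap_swap {a b : V} {e : Finset V} (ha : a ∈ e) (hb : b ∉ e) :
    swap b a (swap a b e) = e := by
  have : b ∉ e.erase a := fun h => hb (mem_of_mem_erase h)
  rw [swap, swap, erase_insert this, insert_erase ha]

lemma erase_swap {a b : V} {e : Finset V} (hb : b ∉ e) : (swap a b e).erase b = e.erase a := by
  have : b ∉ e.erase a := fun h => hb (mem_of_mem_erase h)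
  rw [swap, erase_insert this]

lemma notMem_swap {a b : V} {e : Finset V} (hab : a ≠ b) : a ∉ swap a b e := by
  simp [swap, hab]

lemma mem_swap (a b : V) (e : Finset V) : b ∈ swap a b e := by simp [swap]

lemma card_swap {a b : V} {e : Finset V} (ha : a ∈ e) (hb : b ∉ e) : #(swap a b e) = #e := by
  have : b ∉ e.erase a := fun h => hb (mem_of_mem_erase h)
  rw [swap, card_insert_of_notMem this, card_erase_add_one ha]

lemma linkWt_eq {a b : V} (hab : a ≠ b) (E : Finset (Finset V)) (x : V → ℝ) :
    linkWt E x a = x b * pairWt E x a b + excessWt E x a b +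
      ∑ e ∈ E with a ∈ e ∧ b ∉ e ∧ swap a b e ∈ E, ∏ i ∈ e.erase a, x i := by
  have h : ∀ e ∈ E, (if a ∈ e then ∏ i ∈ e.erase a, x i else 0) =
      x b * (if a ∈ e ∧ b ∈ e then ∏ i ∈ (e.erase a).erase b, x i else 0)
      + (if a ∈ e ∧ b ∉ e ∧ swap a b e ∉ E then ∏ i ∈ e.erase a, x i else 0)
      + (if a ∈ e ∧ b ∉ e ∧ swap a b e ∈ E then ∏ i ∈ e.erase a, x i else 0) := by
    intro e _
    by_cases ha : a ∈ e <;> by_cases hb : b ∈ e <;> by_cases hs : swap a b e ∈ E <;>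
      simp [ha, hb, hs]
    · rw [mul_prod_erase (e.erase a) x (mem_erase.2 ⟨hab.symm, hb⟩)]
    · rw [mul_prod_erase (e.erase a) x (mem_erase.2 ⟨hab.symm, hb⟩)]
  simp only [linkWt, pairWt, excessWt, sum_filter]
  rw [sum_congr rfl h, sum_add_distrib, sum_add_distrib, mul_sum]

/-- Swapping `a` and `b` matches the movable edges at `a` with those at `b`, with equal link
products, so they cancel. Only the edges through both vertices and the unmovable edges remain. -/
lemma linkWt_sub {a b : V} (hab : a ≠ b) (E : Finset (Finset V)) (x : V → ℝ) :
    linkWt E x a - linkWt E x b =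
      (x b - x a) * pairWt E x a b + excessWt E x a b - excessWt E x b a := by
  have hsw : (∑ e ∈ E with a ∈ e ∧ b ∉ e ∧ swap a b e ∈ E, ∏ i ∈ e.erase a, x i) =
      ∑ e ∈ E with b ∈ e ∧ a ∉ e ∧ swap b a e ∈ E, ∏ i ∈ e.erase b, x i := by
    refine sum_bij' (fun e _ => swap a b e) (fun e _ => swap b a e) ?_ ?_ ?_ ?_ ?_
    · intro e he
      simp only [mem_filter] at he ⊢
      refine ⟨he.2.2.2, mem_swap _ _ _, notMem_swap hab, ?_⟩
      rw [swap_swap he.2.1 he.2.2.1]; exact he.1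
    · intro e he
      simp only [mem_filter] at he ⊢
      refine ⟨he.2.2.2, mem_swap _ _ _, notMem_swap hab.symm, ?_⟩
      rw [swap_swap he.2.1 he.2.2.1]; exact he.1
    · intro e he
      simp only [mem_filter] at he
      exact swap_swap he.2.1 he.2.2.1
    · intro e he
      simp only [mem_filter] at he
      exact swap_swap he.2.1 he.2.2.1
    · intro e he
      simp only [mem_filter] at he
      rw [erase_swap he.2.2.1]
  rw [linkWt_eq hab, linkWt_eq hab.symm, hsw, pairWt_comm E x b a]
  ring

lemma sum_edges_of_pair [Fintype V] {E : Finset (Finset V)} (h3 : ∀ e ∈ E, #e = 3) {a b : V}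
    (hab : a ≠ b) (φ : Finset V → ℝ) :
    ∑ e ∈ E with a ∈ e ∧ b ∈ e, φ e =
      ∑ w : V with w ≠ a ∧ w ≠ b ∧ {a, b, w} ∈ E, φ {a, b, w} := by
  symm
  refine sum_bij (fun w _ => {a, b, w}) ?_ ?_ ?_ ?_
  · intro w hw
    simp only [mem_filter, mem_univ, true_and] at hw
    simp [hw.2.2]
  · intro w hw w' hw' h
    simp only [mem_filter, mem_univ, true_and] at hw hw'
    have : w ∈ ({a, b, w'} : Finset V) := h ▸ by simp
    simpa [hw.1, hw.2.1] using this
  · intro e he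
    simp only [mem_filter] at he
    have hc : #((e.erase a).erase b) = 1 := by
      rw [card_erase_of_mem (mem_erase.2 ⟨hab.symm, he.2.2⟩), card_erase_of_mem he.2.1, h3 e he.1]
    obtain ⟨w, hw⟩ := card_eq_one.1 hc
    have hwm : w ∈ (e.erase a).erase b := by simp [hw]
    simp only [mem_erase] at hwm
    have : ({a, b, w} : Finset V) = e := by
      rw [← insert_erase he.2.1, ← insert_erase (mem_erase.2 ⟨hab.symm, he.2.2⟩), hw]
    refine ⟨w, ?_, this⟩
    simp only [mem_filter, mem_univ, true_and]
    exact ⟨hwm.2.1, hwm.1, this ▸ he.1⟩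
  · intro w _; rfl

lemma triple_erase_erase {a b w : V} (hab : a ≠ b) (ha : w ≠ a) (hb : w ≠ b) :
    ((({a, b, w} : Finset V)).erase a).erase b = {w} := by
  rw [erase_insert (by simp [hab, ha.symm]), erase_insert (by simp [hb.symm])]

lemma pairWt_eq [Fintype V] {E : Finset (Finset V)} (h3 : ∀ e ∈ E, #e = 3) {a b : V}
    (hab : a ≠ b) (x : V → ℝ) :
    pairWt E x a b = ∑ w : V with w ≠ a ∧ w ≠ b ∧ {a, b, w} ∈ E, x w := by
  rw [pairWt, sum_edges_of_pair h3 hab]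
  refine sum_congr rfl fun w hw => ?_
  simp only [mem_filter, mem_univ, true_and] at hw
  rw [triple_erase_erase hab hw.1 hw.2.1, prod_singleton]

lemma pairWt_nonneg {E : Finset (Finset V)} {x : V → ℝ} (hx : ∀ i, 0 ≤ x i) (a b : V) :
    0 ≤ pairWt E x a b := sum_nonneg fun _ _ => prod_nonneg fun i _ => hx i

lemma excessWt_nonneg {E : Finset (Finset V)} {x : V → ℝ} (hx : ∀ i, 0 ≤ x i) (a b : V) :
    0 ≤ excessWt E x a b := sum_nonneg fun _ _ => prod_nonneg fun i _ => hx i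

lemma wt_insert {E : Finset (Finset V)} {e : Finset V} (he : e ∉ E) (x : V → ℝ) :
    wt (insert e E) x = ∏ i ∈ e, x i + wt E x := sum_insert he

lemma wt_mono {W : Type*} {E E' : Finset (Finset W)} (h : E ⊆ E') {x : W → ℝ} (hx : ∀ i, 0 ≤ x i) :
    wt E x ≤ wt E' x :=
  sum_le_sum_of_subset_of_nonneg h fun _ _ _ => prod_nonneg fun i _ => hx i

end Weights

/-! ### Extremal pairs: optimality conditions and the size of the support. -/

section Extremal

variable {V : Type*} [DecidableEq V] [Fintype V]

/-- `(E, x)` maximises the Lagrangian polynomial among all pairs consisting of a family of at most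
`m` triples of `V` and a point of the simplex. -/
structure IsExtremal (m : ℕ) (E : Finset (Finset V)) (x : V → ℝ) : Prop where
  card_eq : ∀ e ∈ E, #e = 3
  card_le : #E ≤ m
  mem : x ∈ stdSimplex ℝ V
  wt_le : ∀ E' : Finset (Finset V), (∀ e ∈ E', #e = 3) → #E' ≤ m → ∀ x' ∈ stdSimplex ℝ V,
    wt E' x' ≤ wt E x

/-- Any two vertices of positive weight lie in a common edge. -/
def PairCovered (E : Finset (Finset V)) (x : V → ℝ) : Prop :=
  ∀ a b, a ≠ b → 0 < x a → 0 < x b → ∃ e ∈ E, a ∈ e ∧ b ∈ e ∧ ∀ i ∈ e, 0 < x i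

lemma continuous_wt (E : Finset (Finset V)) : Continuous (wt E) := by
  unfold wt; fun_prop

lemma sum_shift {a b : V} (hab : a ≠ b) (x : V → ℝ) (t : ℝ) :
    ∑ i, shift x a b t i = ∑ i, x i := by
  have h : ∀ i, shift x a b t i = x i + ((if i = a then t else 0) - (if i = b then t else 0)) := by
    intro i
    by_cases ha : i = a
    · subst ha; simp [shift_left, hab]
    · by_cases hb : i = b
      · subst hb; simp [shift_right x hab, ha]; ring
      · simp [shift_of_ne x ha hb, ha, hb]
  simp [h, sum_add_distrib]

lemma shift_mem_stdSimplex {a b : V} (hab : a ≠ b) {x : V → ℝ} (hx : x ∈ stdSimplex ℝ V) {t : ℝ}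
    (h1 : -x a ≤ t) (h2 : t ≤ x b) : shift x a b t ∈ stdSimplex ℝ V := by
  refine ⟨fun i => ?_, by rw [sum_shift hab]; exact hx.2⟩
  by_cases ha : i = a
  · subst ha; rw [shift_left]; linarith
  · by_cases hb : i = b
    · subst hb; rw [shift_right x hab]; linarith
    · rw [shift_of_ne x ha hb]; exact hx.1 i

lemma exists_isExtremal [Nonempty V] (m : ℕ) :
    ∃ (E : Finset (Finset V)) (x : V → ℝ), IsExtremal m E x := by
  have hne : (stdSimplex ℝ V).Nonempty := by
    obtain ⟨v⟩ := ‹Nonempty V›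
    exact ⟨_, single_mem_stdSimplex ℝ v⟩
  have hmax : ∀ E : Finset (Finset V), ∃ x ∈ stdSimplex ℝ V, ∀ y ∈ stdSimplex ℝ V,
      wt E y ≤ wt E x := fun E =>
    (isCompact_stdSimplex ℝ V).exists_isMaxOn hne (continuous_wt E).continuousOn
  choose X hX hXmax using hmax
  let 𝓔 : Finset (Finset (Finset V)) := {E | (∀ e ∈ E, #e = 3) ∧ #E ≤ m}
  obtain ⟨E, hE, hEmax⟩ := 𝓔.exists_max_image (fun E => wt E (X E)) ⟨∅, by simp [𝓔]⟩
  simp only [𝓔, mem_filter, mem_univ, true_and] at hE hEmax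
  exact ⟨E, X E, hE.1, hE.2, hX E, fun E' h3 hc x' hx' =>
    (hXmax E' x' hx').trans (hEmax E' ⟨h3, hc⟩)⟩

namespace IsExtremal

variable {m : ℕ} {E : Finset (Finset V)} {x : V → ℝ}

lemma nonneg (h : IsExtremal m E x) (i : V) : 0 ≤ x i := h.mem.1 i

lemma of_wt_eq (h : IsExtremal m E x) {E' : Finset (Finset V)} {x' : V → ℝ}
    (h3 : ∀ e ∈ E', #e = 3) (hc : #E' ≤ m) (hx' : x' ∈ stdSimplex ℝ V)
    (hw : wt E x ≤ wt E' x') : IsExtremal m E' x' :=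
  ⟨h3, hc, hx', fun E'' h3' hc' y hy => (h.wt_le E'' h3' hc' y hy).trans hw⟩

/-- First-order optimality. Only `b` needs positive weight, so a vertex `a` of weight zero is
allowed; `le_card_support` relies on that case. -/
lemma linkWt_le (h : IsExtremal m E x) {a b : V} (hab : a ≠ b) (hb : 0 < x b) :
    linkWt E x a ≤ linkWt E x b := by
  by_contra! hlt
  set A := linkWt E x a - linkWt E x b with hA
  have hApos : 0 < A := sub_pos.2 hlt
  set S := pairWt E x a b with hS
  have hS0 : 0 ≤ S := pairWt_nonneg h.nonneg a b
  -- Small enough that the quadratic loss `t ^ 2 * S` is at most half of the linear gain `t * A`.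
  set t := min (x b) (A / (2 * (S + 1)))
  have ht : 0 < t := lt_min hb (by positivity)
  have ht2 : t * (2 * (S + 1)) ≤ A := by
    rw [← le_div_iff₀ (by positivity)]; exact min_le_right _ _
  have := h.wt_le E h.card_eq h.card_le (shift x a b t)
    (shift_mem_stdSimplex hab h.mem (by linarith [h.nonneg a]) (min_le_left _ _))
  rw [wt_shift hab, ← hA, ← hS] at this
  nlinarith [mul_pos ht hApos, mul_nonneg ht.le hS0, mul_le_mul_of_nonneg_left ht2 ht.le]

lemma linkWt_eq (h : IsExtremal m E x) {a b : V} (hab : a ≠ b) (ha : 0 < x a) (hb : 0 < x b) :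
    linkWt E x a = linkWt E x b :=
  le_antisymm (h.linkWt_le hab hb) (h.linkWt_le hab.symm ha)

lemma wt_shift_eq (h : IsExtremal m E x) {a b : V} (hab : a ≠ b) (ha : 0 < x a) (hb : 0 < x b)
    (t : ℝ) : wt E (shift x a b t) = wt E x - t ^ 2 * pairWt E x a b := by
  rw [wt_shift hab, h.linkWt_eq hab ha hb]; ring

lemma sub_mul_pairWt (h : IsExtremal m E x) {a b : V} (hab : a ≠ b) (ha : 0 < x a)
    (hb : 0 < x b) : (x a - x b) * pairWt E x a b = excessWt E x a b - excessWt E x b a := by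
  have := linkWt_sub hab E x
  rw [h.linkWt_eq hab ha hb] at this
  linarith

/-- Trading `e` for `swap i j e` changes the polynomial by `x j - x i` times the product over the
rest of `e`, which is positive. -/
lemma le_of_swap_notMem (h : IsExtremal m E x) {i j : V} {e : Finset V} (he : e ∈ E) (hi : i ∈ e)
    (hj : j ∉ e) (hs : swap i j e ∉ E) (hpos : ∀ w ∈ e, w ≠ i → 0 < x w) : x j ≤ x i := by
  have hs' : swap i j e ∉ E.erase e := fun hh => hs (mem_of_mem_erase hh)
  have hmax := h.wt_le (insert (swap i j e) (E.erase e)) (by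
    intro f hf
    rcases mem_insert.1 hf with rfl | hf
    · rw [card_swap hi hj, h.card_eq e he]
    · exact h.card_eq f (mem_of_mem_erase hf)) (by
    rw [card_insert_of_notMem hs', card_erase_add_one he]; exact h.card_le) x h.mem
  have hE : wt E x = ∏ i ∈ e, x i + wt (E.erase e) x := by
    rw [← wt_insert (notMem_erase e E), insert_erase he]
  rw [wt_insert hs', hE, ← mul_prod_erase _ x (mem_swap i j e), erase_swap hj,
    ← mul_prod_erase e x hi] at hmax
  have hp : 0 < ∏ w ∈ e.erase i, x w :=
    prod_pos fun w hw => hpos w (mem_of_mem_erase hw) (ne_of_mem_erase hw)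
  nlinarith

/-- Exchanging an edge for an equally heavy one keeps extremality. -/
lemma exchange (h : IsExtremal m E x) {i j : V} {e : Finset V} (he : e ∈ E) (hi : i ∈ e)
    (hj : j ∉ e) (hs : swap i j e ∉ E) (hij : x j = x i) :
    IsExtremal m (insert (swap i j e) (E.erase e)) x := by
  have hs' : swap i j e ∉ E.erase e := fun hh => hs (mem_of_mem_erase hh)
  refine h.of_wt_eq ?_ ?_ h.mem (le_of_eq ?_)
  · intro f hf
    rcases mem_insert.1 hf with rfl | hf
    · rw [card_swap hi hj, h.card_eq e he]
    · exact h.card_eq f (mem_of_mem_erase hf)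
  · rw [card_insert_of_notMem hs', card_erase_add_one he]; exact h.card_le
  · rw [wt_insert hs', ← mul_prod_erase _ x (mem_swap i j e), erase_swap hj, hij,
      mul_prod_erase e x hi, ← wt_insert (notMem_erase e E), insert_erase he]

/-- With positive weights an extremal family has as many edges as possible. -/
lemma card_eq_of_lt (h : IsExtremal m E x) (hpos : ∀ i, 0 < x i)
    (hm : m < (Fintype.card V).choose 3) : #E = m := by
  by_contra hne
  have hlt : #E < m := lt_of_le_of_ne h.card_le hne
  have : ∃ f ∈ (univ : Finset V).powersetCard 3, f ∉ E := by
    by_contra! hall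
    have := card_le_card (show (univ : Finset V).powersetCard 3 ⊆ E from hall)
    rw [card_powersetCard, card_univ] at this
    omega
  obtain ⟨f, hf, hfE⟩ := this
  have := h.wt_le (insert f E) (by
    intro g hg
    rcases mem_insert.1 hg with rfl | hg
    · exact (mem_powersetCard.1 hf).2
    · exact h.card_eq g hg) (by rw [card_insert_of_notMem hfE]; exact hlt) x h.mem
  rw [wt_insert hfE] at this
  linarith [prod_pos (s := f) fun i _ => hpos i]

/-- Some extremal weighting of `E` has all pairs in its support covered. -/
lemma exists_pairCovered (h : IsExtremal m E x) :
    ∃ x', IsExtremal m E x' ∧ wt E x' = wt E x ∧ PairCovered E x' := by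
  induction hk : #{i | 0 < x i} using Nat.strong_induction_on generalizing x with
  | _ k ih =>
  by_cases hc : PairCovered E x
  · exact ⟨x, h, rfl, hc⟩
  simp only [PairCovered] at hc
  push Not at hc
  obtain ⟨a, b, hab, ha, hb, hno⟩ := hc
  have hZ : pairWt E x a b = 0 := by
    refine sum_eq_zero fun e he => ?_
    simp only [mem_filter] at he
    obtain ⟨i, hi, hxi⟩ := hno e he.1 he.2.1 he.2.2
    have hxi0 : x i = 0 := le_antisymm hxi (h.nonneg i)
    refine prod_eq_zero (i := i) ?_ hxi0
    refine mem_erase.2 ⟨?_, mem_erase.2 ⟨?_, hi⟩⟩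
    · rintro rfl; exact hb.ne' hxi0
    · rintro rfl; exact ha.ne' hxi0
  -- Linear and quadratic terms both vanish, so emptying `b` into `a` costs nothing and shrinks the
  -- support.
  have hw : wt E (shift x a b (x b)) = wt E x := by
    rw [h.wt_shift_eq hab ha hb, hZ]; ring
  have hext : IsExtremal m E (shift x a b (x b)) :=
    h.of_wt_eq h.card_eq h.card_le (shift_mem_stdSimplex hab h.mem (by linarith) le_rfl) hw.ge
  have hcard : #{i | 0 < shift x a b (x b) i} < k := by
    rw [← hk]
    refine card_lt_card ⟨fun i hi => ?_, fun hsub => ?_⟩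
    · simp only [mem_filter, mem_univ, true_and] at hi ⊢
      by_cases hia : i = a
      · rwa [hia]
      by_cases hib : i = b
      · rwa [hib]
      rwa [shift_of_ne x hia hib] at hi
    · have := hsub (show b ∈ ({i | 0 < x i} : Finset V) by simpa using hb)
      simp [shift_right x hab] at this
  obtain ⟨x', h1, h2, h3⟩ := ih _ hcard hext rfl
  exact ⟨x', h1, h2.trans hw, h3⟩

/-- The support of an extremal weighting is as large as the number of edges permits. -/
lemma le_card_support (h : IsExtremal m E x) {n : ℕ} (hn : n.choose 3 ≤ m)
    (hV : n ≤ Fintype.card V) (hw : 0 < wt E x) : n ≤ #{i | 0 < x i} := by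
  by_contra! hlt
  set P : Finset V := {i | 0 < x i} with hP
  have hx0 : ∀ i, i ∉ P → x i = 0 := fun i hi =>
    le_antisymm (by simpa [hP] using hi) (h.nonneg i)
  obtain ⟨w, hwP⟩ : ∃ w, w ∉ P := by
    by_contra! hall
    have : P = univ := eq_univ_iff_forall.2 hall
    rw [this, card_univ] at hlt
    omega
  -- There are enough edges available for the complete family on the support and one more vertex
  -- `w`. It is still extremal, yet its derivative at the weightless `w` exceeds that at `a`.
  set K := (insert w P).powersetCard 3 with hK
  have hK3 : ∀ e ∈ K, #e = 3 := fun e he => (mem_powersetCard.1 he).2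
  have hKc : #K ≤ m := by
    rw [hK, card_powersetCard, card_insert_of_notMem hwP]
    exact (Nat.choose_le_choose 3 hlt).trans hn
  have hEK : wt E x ≤ wt K x := by
    rw [wt, ← sum_filter_add_sum_filter_not E (fun e => e ⊆ P),
      sum_eq_zero (s := E.filter fun e => ¬ e ⊆ P), add_zero]
    · refine wt_mono (fun e he => ?_) h.nonneg
      rw [mem_filter] at he
      exact mem_powersetCard.2 ⟨he.2.trans (subset_insert _ _), h.card_eq e he.1⟩
    · intro e he
      rw [mem_filter, not_subset] at he
      obtain ⟨i, hi, hiP⟩ := he.2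
      exact prod_eq_zero hi (hx0 i hiP)
  have hKext : IsExtremal m K x := h.of_wt_eq hK3 hKc h.mem hEK
  obtain ⟨e, he, hpe⟩ : ∃ e ∈ E, ∏ i ∈ e, x i ≠ 0 := by
    by_contra! hall
    exact hw.ne' (sum_eq_zero hall)
  have heP : e ⊆ P := fun i hi => by
    by_contra hiP
    exact hpe (prod_eq_zero hi (hx0 i hiP))
  obtain ⟨a, b, c, hab, hac, hbc, rfl⟩ := card_eq_three.1 (h.card_eq e he)
  have haP : a ∈ P := heP (by simp)
  have hbP : b ∈ P := heP (by simp)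
  have hwa : w ≠ a := fun hh => hwP (hh ▸ haP)
  have hwb : w ≠ b := fun hh => hwP (hh ▸ hbP)
  have hxa : 0 < x a := by simpa [hP] using haP
  have hxb : 0 < x b := by simpa [hP] using hbP
  have hex : ∀ p q : V, p ∈ insert w P → q ∈ insert w P → excessWt K x p q = 0 := by
    intro p q _ hq
    refine sum_eq_zero fun f hf => absurd ?_ (mem_filter.1 hf).2.2.2
    obtain ⟨hfK, hpf, hqf, -⟩ := mem_filter.1 hf
    refine mem_powersetCard.2 ⟨?_, by rw [card_swap hpf hqf, hK3 f hfK]⟩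
    exact insert_subset hq ((erase_subset _ _).trans (mem_powersetCard.1 hfK).1)
  have hle := hKext.linkWt_le hwa hxa
  have hsub := linkWt_sub hwa K x
  rw [hex w a (by simp) (by simp [haP]), hex a w (by simp [haP]) (by simp), hx0 w hwP] at hsub
  have hZ : 0 < pairWt K x w a := by
    rw [pairWt_eq hK3 hwa]
    refine sum_pos' (fun i _ => h.nonneg i) ⟨b, ?_, hxb⟩
    simp only [mem_filter, mem_univ, true_and]
    refine ⟨hwb.symm, hab.symm, mem_powersetCard.2 ⟨?_, ?_⟩⟩
    · intro i; simp only [mem_insert, mem_singleton]; rintro (rfl | rfl | rfl) <;> simp [haP, hbP]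
    · rw [card_eq_three]; exact ⟨w, a, b, hwa, hwb, hab, rfl⟩
  nlinarith [mul_pos hxa hZ]

end IsExtremal

end Extremal

/-! ### Left-compression that keeps a covered pair. -/

/-- `E` is closed under replacing a vertex of an edge by a smaller vertex. -/
def Shifted {k : ℕ} (E : Finset (Finset (Fin k))) : Prop :=
  ∀ i j : Fin k, i < j → ∀ e ∈ E, j ∈ e → i ∉ e → swap j i e ∈ E

namespace IsExtremal

section Free

variable {V : Type*} [DecidableEq V] [Fintype V] {m : ℕ} {E : Finset (Finset V)} {x : V → ℝ}

/-- If no edge contains both `a` and `b`, then weight can be moved freely between `a` and `b`, so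
that every lighter vertex can be exchanged for `a`. -/
lemma swap_mem_of_lt_add (h : IsExtremal m E x) (hpos : ∀ i, 0 < x i) {a b : V} (hab : a ≠ b)
    (hno : ∀ e ∈ E, a ∈ e → b ∉ e) {i : V} (hia : i ≠ a) (hib : i ≠ b) (hi : x i < x a + x b)
    {e : Finset V} (he : e ∈ E) (hie : i ∈ e) (hae : a ∉ e) : swap i a e ∈ E := by
  by_contra hs
  have hZ : pairWt E x a b = 0 := by
    refine sum_eq_zero fun f hf => ?_
    rw [mem_filter] at hf
    exact absurd hf.2.2 (hno f hf.1 hf.2.1)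
  -- A midpoint: `a` becomes heavier than `i` while `b` keeps positive weight.
  set t := (max 0 (x i - x a) + x b) / 2 with ht
  have h0 : (0 : ℝ) ≤ max 0 (x i - x a) := le_max_left _ _
  have h1 : x i - x a ≤ max 0 (x i - x a) := le_max_right _ _
  have h2 : max 0 (x i - x a) < x b := max_lt (hpos b) (by linarith)
  have hext : IsExtremal m E (shift x a b t) := by
    refine h.of_wt_eq h.card_eq h.card_le
      (shift_mem_stdSimplex hab h.mem (by linarith [hpos a, hpos b]) (by linarith)) ?_
    rw [h.wt_shift_eq hab (hpos a) (hpos b), hZ]; simp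
  have := hext.le_of_swap_notMem he hie hae hs (by
    intro w _ _
    by_cases hwa : w = a
    · subst hwa; rw [shift_left]; linarith [hpos w, hpos b]
    by_cases hwb : w = b
    · subst hwb; rw [shift_right x hab]; linarith
    rw [shift_of_ne x hwa hwb]; exact hpos w)
  rw [shift_left, shift_of_ne x hia hib] at this
  linarith

/-- If some edge has two vertices of weight less than `x a + x b`, then some edge contains both
`a` and `b`. -/
lemma exists_pair_edge (h : IsExtremal m E x) (hpos : ∀ i, 0 < x i) {a b : V} (hab : a ≠ b)
    (hT : ∃ e ∈ E, ∃ i ∈ e, ∃ j ∈ e, i ≠ j ∧ x i < x a + x b ∧ x j < x a + x b) :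
    ∃ e ∈ E, a ∈ e ∧ b ∈ e := by
  by_contra! hno
  have hno' : ∀ e ∈ E, b ∈ e → a ∉ e := fun e he hb ha => hno e he ha hb
  have key : ∀ e ∈ E, a ∈ e → ∀ i ∈ e, i ≠ a → x i < x a + x b → False := by
    intro e he hae i hie hia hi
    have hib : i ≠ b := fun hh => hno e he hae (hh ▸ hie)
    have := h.swap_mem_of_lt_add hpos hab.symm hno' hib hia (by linarith) he hie (hno e he hae)
    refine hno _ this ?_ (mem_swap _ _ _)
    exact mem_insert_of_mem (mem_erase.2 ⟨hia.symm, hae⟩)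
  obtain ⟨e, he, i, hie, j, hje, hij, hi, hj⟩ := hT
  by_cases hae : a ∈ e
  · by_cases hia : i = a
    · exact key e he hae j hje (by rintro rfl; exact hij hia) hj
    · exact key e he hae i hie hia hi
  -- If `e` avoids `a`, replace one light vertex by `a`; the other light vertex makes the new edge
  -- contradict `key`.
  have : ∀ p ∈ e, ∀ q ∈ e, p ≠ q → x p < x a + x b → x q < x a + x b → p ≠ b → False := by
    intro p hp q hq hpq hxp hxq hpb
    have hm := h.swap_mem_of_lt_add hpos hab hno (fun hh => hae (hh ▸ hp)) hpb hxp he hp hae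
    exact key _ hm (mem_swap _ _ _) q (mem_insert_of_mem (mem_erase.2 ⟨hpq.symm, hq⟩))
      (fun hh => hae (hh ▸ hq)) hxq
  by_cases hib : i = b
  · exact this j hje i hie hij.symm hj hi (by rintro rfl; exact hij hib)
  · exact this i hie j hje hij hi hj hib

end Free

variable {k m : ℕ} {E : Finset (Finset (Fin k))} {x : Fin k → ℝ}

/-- Exchanging edges between vertices of equal weight makes an extremal family shifted; the
existence of an edge with two light vertices is preserved. -/
lemma exists_shifted (h : IsExtremal m E x) (hpos : ∀ i, 0 < x i) (hanti : Antitone x) (c : ℝ)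
    (hT : ∃ e ∈ E, ∃ i ∈ e, ∃ j ∈ e, i ≠ j ∧ x i < c ∧ x j < c) :
    ∃ E', IsExtremal m E' x ∧ wt E' x = wt E x ∧ Shifted E' ∧
      ∃ e ∈ E', ∃ i ∈ e, ∃ j ∈ e, i ≠ j ∧ x i < c ∧ x j < c := by
  -- Each exchange replaces a vertex by a smaller one of equal weight, so the sum of all labels
  -- drops.
  induction hN : ∑ e ∈ E, ∑ i ∈ e, (i : ℕ) using Nat.strong_induction_on generalizing E with
  | _ N ih =>
  by_cases hS : Shifted E
  · exact ⟨E, h, rfl, hS, hT⟩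
  simp only [Shifted] at hS
  push Not at hS
  obtain ⟨i, j, hij, e, he, hje, hie, hs⟩ := hS
  have hxij : x i = x j := le_antisymm (h.le_of_swap_notMem he hje hie hs fun w _ _ => hpos w)
    (hanti hij.le)
  have hext := h.exchange he hje hie hs hxij
  have hw : wt (insert (swap j i e) (E.erase e)) x = wt E x :=
    le_antisymm (h.wt_le _ hext.card_eq hext.card_le x h.mem) (hext.wt_le _ h.card_eq h.card_le x h.mem)
  have hs' : swap j i e ∉ E.erase e := fun hh => hs (mem_of_mem_erase hh)
  have hlt : ∑ f ∈ insert (swap j i e) (E.erase e), ∑ i ∈ f, (i : ℕ) < N := by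
    rw [sum_insert hs', ← hN, ← add_sum_erase E _ he, ← add_sum_erase _ _ (mem_swap j i e),
      erase_swap hie, ← add_sum_erase e _ hje]
    have : (i : ℕ) < j := hij
    omega
  obtain ⟨E', h1, h2, h3, h4⟩ := ih _ hlt hext (by
    obtain ⟨f, hf, p, hp, q, hq, hpq, hxp, hxq⟩ := hT
    by_cases hfe : f = e
    · subst hfe
      refine ⟨_, mem_insert_self _ _, ?_⟩
      have hmem : ∀ r ∈ f, r ≠ j → r ∈ swap j i f := fun r hr hrj =>
        mem_insert_of_mem (mem_erase.2 ⟨hrj, hr⟩)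
      by_cases hpj : p = j
      · subst hpj
        exact ⟨i, mem_swap _ _ _, q, hmem q hq hpq.symm, by rintro rfl; exact hie hq,
          by linarith, hxq⟩
      by_cases hqj : q = j
      · subst hqj
        exact ⟨p, hmem p hp hpq, i, mem_swap _ _ _, by rintro rfl; exact hie hp, hxp, by linarith⟩
      exact ⟨p, hmem p hp hpj, q, hmem q hq hqj, hpq, hxp, hxq⟩
    · exact ⟨f, mem_insert_of_mem (mem_erase.2 ⟨hfe, hf⟩), p, hp, q, hq, hpq, hxp, hxq⟩) rfl
  exact ⟨E', h1, h2.trans hw, h3, h4⟩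

/-- Compression may destroy the edge through `a` and `b`. What survives is an edge with two vertices
lighter than `x a + x b`, and by `exists_pair_edge` this forces some edge through both. -/
lemma exists_shifted_pair (h : IsExtremal m E x) (hpos : ∀ i, 0 < x i) (hanti : Antitone x)
    {a b : Fin k} (hab : a ≠ b) (hcov : ∃ e ∈ E, a ∈ e ∧ b ∈ e) :
    ∃ E', IsExtremal m E' x ∧ wt E' x = wt E x ∧ Shifted E' ∧ ∃ e ∈ E', a ∈ e ∧ b ∈ e := by
  obtain ⟨e, he, hae, hbe⟩ := hcov
  obtain ⟨E', h1, h2, h3, h4⟩ := h.exists_shifted hpos hanti (x a + x b)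
    ⟨e, he, a, hae, b, hbe, hab, by linarith [hpos b], by linarith [hpos a]⟩
  exact ⟨E', h1, h2, h3, h1.exists_pair_edge hpos hab h4⟩

end IsExtremal

/-! ### Averaging and the numerical inequalities comparing gain with loss. -/

/-- A subset of prescribed size whose average is at least the average of the whole set. -/
lemma exists_subset_card_mul_sum_le {ι : Type*} [DecidableEq ι] (w : ι → ℝ) {g : ℕ} (s : Finset ι)
    (hg : g ≤ #s) : ∃ t ⊆ s, #t = g ∧ (g : ℝ) * ∑ i ∈ s, w i ≤ #s * ∑ i ∈ t, w i := by
  induction hn : #s generalizing s with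
  | zero => exact ⟨∅, by simp, by simp; omega, by simp [show g = 0 by omega]⟩
  | succ n ih =>
    rcases hg.eq_or_lt with hgs | hgs
    · exact ⟨s, subset_rfl, hgs.symm, by rw [← hn, hgs]⟩
    · have hne : s.Nonempty := by rw [← card_pos]; omega
      obtain ⟨a, ha, hmin⟩ := s.exists_min_image w hne
      have hcard : #(s.erase a) = n := by rw [card_erase_of_mem ha]; omega
      obtain ⟨t, hts, htg, hle⟩ := ih (s.erase a) (by omega) hcard
      refine ⟨t, hts.trans (erase_subset _ _), htg, ?_⟩
      have h1 : (g : ℝ) * w a ≤ ∑ i ∈ t, w i := by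
        have := card_nsmul_le_sum t w (w a) fun i hi => hmin i (mem_of_mem_erase (hts hi))
        rwa [htg, nsmul_eq_mul] at this
      rw [← add_sum_erase s w ha]
      push_cast
      linarith

/-- Multiplying `hdiff` by `b * xv` and cancelling `R` gives `b * xv * x0 < P + b * xv * (xu + xv)`.
After another factor `xv`, the term with `P` is matched in `hG`, and the rest is at most `2 * b * xu
* xv ^ 2`, paid for by `g * (xu * c ^ 2)`. -/
lemma gain_of_few_missing {xu xv x0 c R Q P S b g G : ℝ} (hv : 0 < xv) (hvu : xv ≤ xu)
    (huc : xu ≤ c) (hb : 1 ≤ b) (hP : 0 ≤ P) (hQ : 0 ≤ Q) (hR : 0 < R)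
    (hdiff : (x0 - xu) * R ≤ P + xv * Q) (hbQ : b * xv + Q ≤ R) (hS : S ≤ b * x0)
    (hg : 2 * b ≤ g) (hG : xv * P + g * (xu * c ^ 2) ≤ G) : xv ^ 2 * S < G := by
  have hh : 0 < b * xv := by positivity
  have e1 : (b * xv) * ((x0 - xu) * R) ≤ (b * xv) * (P + xv * Q) :=
    mul_le_mul_of_nonneg_left hdiff hh.le
  have e2 : (b * xv) * P ≤ R * P := mul_le_mul_of_nonneg_right (by linarith) hP
  have e3 : (b * xv * xv) * Q ≤ (b * xv * xv) * (R - b * xv) :=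
    mul_le_mul_of_nonneg_left (by linarith) (by positivity)
  have e4 : 0 < (b * xv * xv) * (b * xv) := by positivity
  have e5 : 0 < R * (b * xv * xu + P + b * xv * xv - b * xv * x0) := by nlinarith
  have e6 : 0 < b * xv * xu + P + b * xv * xv - b * xv * x0 := pos_of_mul_pos_right e5 hR.le
  have e7 : xv ^ 2 * S ≤ xv ^ 2 * (b * x0) := mul_le_mul_of_nonneg_left hS (by positivity)
  have e8 : 0 < xv * (b * xv * xu + P + b * xv * xv - b * xv * x0) := mul_pos hv e6
  have hxu : 0 < xu := hv.trans_le hvu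
  have e9 : b * xv ^ 2 * xv ≤ b * xv ^ 2 * xu := mul_le_mul_of_nonneg_left hvu (by positivity)
  have e10 : xv ^ 2 ≤ c ^ 2 := pow_le_pow_left₀ hv.le (hvu.trans huc) 2
  have e11 : (2 * b) * (xu * xv ^ 2) ≤ g * (xu * c ^ 2) :=
    mul_le_mul hg (mul_le_mul_of_nonneg_left e10 hxu.le) (by positivity) (by linarith)
  nlinarith

/-- Now `P` is controlled only through the average bound `hgP`. Since `ν * xv ≤ (k - 3) * R / 2`,
the factor `R` cancels again. Multiplying by `xv` gives `2 * g * b * xv ^ 2 * x0 < (b * (k + 1) / 2)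
* (xu + xv) * PF`, and `b * (k + 1) ≤ 4 * g` finishes. -/
lemma gain_of_many_missing {xu xv x0 c R Q P S b g ν PF k : ℝ} (hv : 0 < xv) (hvu : xv ≤ xu)
    (huc : xu ≤ c) (hb : 1 ≤ b) (hR : 0 < R) (hk : 6 ≤ k) (hPF : 0 ≤ PF)
    (hdiff : (x0 - xu) * R ≤ P + xv * Q) (hbQ : b * xv + Q ≤ R) (hS : S ≤ b * x0)
    (hkR : (k - 2) * xv ≤ R) (hν : 2 * ν ≤ (k - 2) * (k - 3)) (hbg : b * (k - 2) ≤ 2 * g)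
    (hgP : g * P ≤ ν * PF) (hcPF : g * c ^ 2 ≤ PF) : xv ^ 2 * S < (xu + xv) * PF := by
  have hxu : 0 < xu := hv.trans_le hvu
  have hg : 0 < g := by nlinarith
  have hh : 0 < b * xv := by positivity
  have e1 : (g * (b * xv)) * ((x0 - xu) * R) ≤ (g * (b * xv)) * (P + xv * Q) :=
    mul_le_mul_of_nonneg_left hdiff (by positivity)
  have e3 : (g * b * xv * xv) * Q < (g * b * xv * xv) * R :=
    mul_lt_mul_of_pos_left (by linarith) (by positivity)
  have e2 : (b * xv) * (g * P) ≤ (b * xv) * (ν * PF) := mul_le_mul_of_nonneg_left hgP hh.le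
  have e4 : (xv * b * PF) * (2 * ν) ≤ (xv * b * PF) * ((k - 2) * (k - 3)) :=
    mul_le_mul_of_nonneg_left hν (by positivity)
  have e5 : (b * PF * (k - 3)) * ((k - 2) * xv) ≤ (b * PF * (k - 3)) * R :=
    mul_le_mul_of_nonneg_left hkR (mul_nonneg (by positivity) (by linarith))
  have e6 : 0 < R * (2 * g * b * xv * (xu + xv) + b * PF * (k - 3) - 2 * g * b * xv * x0) := by
    nlinarith
  have e7 := pos_of_mul_pos_right e6 hR.le
  have e8 : xv ^ 2 * S ≤ xv ^ 2 * (b * x0) := mul_le_mul_of_nonneg_left hS (by positivity)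
  have e9 := mul_pos hv e7
  have e10 : xv ^ 2 ≤ c ^ 2 := pow_le_pow_left₀ hv.le (hvu.trans huc) 2
  have e11 : g * xv ^ 2 ≤ PF := (mul_le_mul_of_nonneg_left e10 hg.le).trans hcPF
  have e12 : (b * (xu + xv)) * (g * xv ^ 2) ≤ (b * (xu + xv)) * PF :=
    mul_le_mul_of_nonneg_left e11 (by positivity)
  have e13 : (b * PF * (k - 3)) * (2 * xv) ≤ (b * PF * (k - 3)) * (xu + xv) :=
    mul_le_mul_of_nonneg_left (by linarith) (mul_nonneg (by positivity) (by linarith))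
  have e14 : ((xu + xv) * PF) * (b * (k + 1)) ≤ ((xu + xv) * PF) * (4 * g) :=
    mul_le_mul_of_nonneg_left (by nlinarith) (by positivity)
  have e15 : g * (xv ^ 2 * S) ≤ g * (xv ^ 2 * (b * x0)) := mul_le_mul_of_nonneg_left e8 hg.le
  have e16 : 0 < g * ((xu + xv) * PF - xv ^ 2 * S) := by nlinarith
  linarith [pos_of_mul_pos_right e16 hg.le]

/-! ### Codegrees and missing triples in shifted families. -/

section

variable {k m : ℕ} {E : Finset (Finset (Fin k))} {x : Fin k → ℝ}

lemma Shifted.triple_mem (hS : Shifted E) {a b c d : Fin k} (h : {a, b, c} ∈ E)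
    (hac : a ≠ c) (hbc : b ≠ c) (hda : d ≠ a) (hdb : d ≠ b) (hd : d ≤ c) : {a, b, d} ∈ E := by
  rcases hd.eq_or_lt with rfl | hlt
  · exact h
  have := hS d c hlt _ h (by simp) (by simp [hda, hdb, hlt.ne])
  convert this using 1
  ext i
  simp only [swap, mem_insert, mem_singleton, mem_erase]
  constructor
  · rintro (rfl | rfl | rfl) <;> simp [hac, hbc]
  · rintro (rfl | ⟨h1, rfl | rfl | rfl⟩) <;> simp_all

/-- The third vertices of the edges through two given vertices. -/
def codegSet (E : Finset (Finset (Fin k))) (a b : Fin k) : Finset (Fin k) :=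
  {w | w ≠ a ∧ w ≠ b ∧ {a, b, w} ∈ E}

lemma mem_codegSet {a b w : Fin k} : w ∈ codegSet E a b ↔ w ≠ a ∧ w ≠ b ∧ {a, b, w} ∈ E := by
  simp [codegSet]

lemma triple_rotate (a b c : Fin k) : ({a, b, c} : Finset (Fin k)) = {b, c, a} := by
  ext; simp only [mem_insert, mem_singleton]; tauto

variable {o u v : Fin k}

lemma Shifted.mem_codegSet_of_exists (hS : Shifted E) (h3 : ∀ e ∈ E, #e = 3) (ho : ∀ i, o ≤ i)
    (hou : o ≠ u) (hov : o ≠ v) (huv : u ≠ v) (hcov : ∃ e ∈ E, u ∈ e ∧ v ∈ e) :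
    o ∈ codegSet E u v := by
  obtain ⟨e, he, hue, hve⟩ := hcov
  have hc : #((e.erase u).erase v) = 1 := by
    rw [card_erase_of_mem (mem_erase.2 ⟨huv.symm, hve⟩), card_erase_of_mem hue, h3 e he]
  obtain ⟨w, hw⟩ := card_eq_one.1 hc
  have hwm : w ∈ (e.erase u).erase v := by simp [hw]
  simp only [mem_erase] at hwm
  have : ({u, v, w} : Finset (Fin k)) = e := by
    rw [← insert_erase hue, ← insert_erase (mem_erase.2 ⟨huv.symm, hve⟩), hw]
  exact mem_codegSet.2 ⟨hou, hov, hS.triple_mem (this ▸ he) hwm.2.1.symm hwm.1.symm hou hov (ho w)⟩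

/-- Double counting: an edge at `v` has only two other vertices. -/
lemma sum_two_mul_degree (h3 : ∀ e ∈ E, #e = 3) (v : Fin k) (B : Finset (Fin k)) (hvB : v ∉ B) :
    ∑ w ∈ B, #{e ∈ E | v ∈ e ∧ w ∈ e} ≤ 2 * #{e ∈ E | v ∈ e} := by
  have h1 : ∀ w ∈ B, #{e ∈ E | v ∈ e ∧ w ∈ e} = ∑ e ∈ E with v ∈ e, if w ∈ e then 1 else 0 := by
    intro w _
    rw [← sum_filter, sum_const, filter_filter, smul_eq_mul, mul_one]
  rw [sum_congr rfl h1, sum_comm, mul_comm, ← smul_eq_mul]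
  refine sum_le_card_nsmul _ _ _ fun e he => ?_
  rw [mem_filter] at he
  rw [← sum_filter, sum_const, smul_eq_mul, mul_one]
  have : {w ∈ B | w ∈ e} ⊆ e.erase v := fun w hw => by
    rw [mem_filter] at hw
    exact mem_erase.2 ⟨fun h => hvB (h ▸ hw.1), hw.2⟩
  have := card_le_card this
  rwa [card_erase_of_mem he.2, h3 e he.1] at this

lemma card_codeg (h3 : ∀ e ∈ E, #e = 3) {a b : Fin k} (hab : a ≠ b) :
    #{e ∈ E | a ∈ e ∧ b ∈ e} = #(codegSet E a b) := by
  have := sum_edges_of_pair h3 hab (fun _ => 1)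
  simpa [codegSet] using this

/-- The members of the codegree set of `u, v` have full codegree with `v`. -/
lemma Shifted.codeg_eq (hS : Shifted E) (huv : u ≠ v)
    (hu : ∀ i, i ≠ v → i ≤ u) {w : Fin k} (hw : w ∈ codegSet E u v) :
    #(codegSet E v w) = k - 2 := by
  obtain ⟨hwu, hwv, hE⟩ := mem_codegSet.1 hw
  have : codegSet E v w = (univ.erase v).erase w := by
    ext j
    simp only [mem_codegSet, mem_erase, mem_univ, and_true]
    constructor
    · rintro ⟨h1, h2, -⟩; exact ⟨h2, h1⟩
    · rintro ⟨h1, h2⟩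
      refine ⟨h2, h1, ?_⟩
      rw [triple_rotate] at hE
      exact hS.triple_mem hE huv.symm hwu h2 h1 (hu j h2)
  rw [this, card_erase_of_mem (by simp [hwv]), card_erase_of_mem (mem_univ _), card_univ,
    Fintype.card_fin]
  omega

/-- Discarding the edges at `v` and moving its weight to `u` makes room for as many missing triples
as there are edges at `v`. -/
lemma IsExtremal.wt_le_of_missing (h : IsExtremal m E x) (hpos : ∀ i, 0 < x i) (huv : u ≠ v)
    {F : Finset (Finset (Fin k))} (hF3 : ∀ f ∈ F, #f = 3)
    (hFE : ∀ f ∈ F, f ∉ E) (hFc : #F ≤ #{e ∈ E | v ∈ e}) :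
    wt F (shift x u v (x v)) ≤ x v ^ 2 * pairWt E x u v := by
  set y := shift x u v (x v) with hy
  have hyv : y v = 0 := by rw [hy, shift_right x huv, sub_self]
  have hdisj : Disjoint {e ∈ E | v ∉ e} F :=
    disjoint_left.2 fun e he hf => hFE e hf (mem_filter.1 he).1
  have hmax := h.wt_le ({e ∈ E | v ∉ e} ∪ F) (by
    intro f hf
    rcases mem_union.1 hf with hf | hf
    · exact h.card_eq f (mem_filter.1 hf).1
    · exact hF3 f hf) (by
    rw [card_union_of_disjoint hdisj]
    have := card_filter_add_card_filter_not (s := E) (fun e => v ∈ e)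
    have := h.card_le
    omega) y (shift_mem_stdSimplex huv h.mem (by linarith [hpos u, hpos v]) le_rfl)
  have hE : wt {e ∈ E | v ∉ e} y = wt E y := by
    rw [wt, wt, ← sum_filter_add_sum_filter_not E (fun e => v ∈ e),
      sum_eq_zero (s := E.filter fun e => v ∈ e), zero_add]
    intro e he
    exact prod_eq_zero (mem_filter.1 he).2 hyv
  have hsum : wt ({e ∈ E | v ∉ e} ∪ F) y = wt {e ∈ E | v ∉ e} y + wt F y := sum_union hdisj
  rw [hsum, hE, hy, h.wt_shift_eq huv (hpos u) (hpos v)] at hmax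
  linarith

/-- The missing triples that avoid `v`. -/
def missing (E : Finset (Finset (Fin k))) (v : Fin k) : Finset (Finset (Fin k)) :=
  (univ.erase v).powersetCard 3 \ E

lemma mem_missing {f : Finset (Fin k)} : f ∈ missing E v ↔ #f = 3 ∧ v ∉ f ∧ f ∉ E := by
  simp only [missing, mem_sdiff, mem_powersetCard, subset_erase, subset_univ, true_and]
  tauto

/-- There are `(k - 1).choose 3` triples avoiding `v`; removing from this count and from `#E` the
edges avoiding `v` preserves the strict inequality. -/
lemma degree_lt_card_missing (hE : #E < (k - 1).choose 3) (v : Fin k) :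
    #{e ∈ E | v ∈ e} < #(missing E v) := by
  have h1 : #(missing E v) + #((univ.erase v).powersetCard 3 ∩ E) = (k - 1).choose 3 := by
    rw [missing, card_sdiff_add_card_inter, card_powersetCard, card_erase_of_mem (mem_univ _),
      card_univ, Fintype.card_fin]
  have h2 : #((univ.erase v).powersetCard 3 ∩ E) ≤ #{e ∈ E | v ∉ e} := by
    refine card_le_card fun e he => ?_
    simp only [mem_inter, mem_powersetCard, subset_erase] at he
    exact mem_filter.2 ⟨he.2, he.1.1.2⟩
  have := card_filter_add_card_filter_not (s := E) (fun e => v ∈ e)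
  omega

/-- Take an edge at `o` that cannot be moved to `u`. If it avoids `v`, its swap is a missing triple
through `u` with the same link product. Otherwise it is `{o, v, p}`, and immovability means that `p`
is outside the codegree set of `u, v`. -/
lemma excessWt_le_missing (h3 : ∀ e ∈ E, #e = 3) (hx : ∀ i, 0 ≤ x i) (hov : o ≠ v)
    (huv : u ≠ v) :
    excessWt E x o u ≤ ∑ f ∈ missing E v with u ∈ f, ∏ i ∈ f.erase u, x i
      + x v * ∑ p with p ∉ codegSet E u v ∧ p ≠ u ∧ p ≠ v, x p := by
  rw [excessWt, ← sum_filter_add_sum_filter_not _ (fun e => v ∉ e), filter_filter, filter_filter]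
  refine add_le_add ?_ ?_
  · have : ∑ e ∈ E with (o ∈ e ∧ u ∉ e ∧ swap o u e ∉ E) ∧ v ∉ e, ∏ i ∈ e.erase o, x i =
        ∑ f ∈ ({e ∈ E | (o ∈ e ∧ u ∉ e ∧ swap o u e ∉ E) ∧ v ∉ e}).image (swap o u),
          ∏ i ∈ f.erase u, x i := by
      rw [sum_image]
      · refine sum_congr rfl fun e he => ?_
        rw [mem_filter] at he
        rw [erase_swap he.2.1.2.1]
      · intro e he e' he' hee
        simp only [coe_filter, Set.mem_ofPred_eq] at he he'
        rw [← swap_swap he.2.1.1 he.2.1.2.1, hee, swap_swap he'.2.1.1 he'.2.1.2.1]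
    rw [this]
    refine sum_le_sum_of_subset_of_nonneg (fun f hf => ?_)
      fun _ _ _ => prod_nonneg fun i _ => hx i
    obtain ⟨e, he, rfl⟩ := mem_image.1 hf
    rw [mem_filter] at he
    obtain ⟨heE, ⟨hoe, hue, hs⟩, hve⟩ := he
    refine mem_filter.2 ⟨mem_missing.2 ⟨by rw [card_swap hoe hue, h3 e heE], ?_, hs⟩, mem_swap _ _ _⟩
    simp only [swap, mem_insert, mem_erase, not_or]
    exact ⟨huv.symm, fun hh => hve hh.2⟩
  · have hfil : ({e ∈ E | (o ∈ e ∧ u ∉ e ∧ swap o u e ∉ E) ∧ ¬ v ∉ e}) =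
        {e ∈ {e ∈ E | u ∉ e ∧ swap o u e ∉ E} | o ∈ e ∧ v ∈ e} := by
      ext e; simp only [mem_filter, not_not]; tauto
    rw [hfil, sum_edges_of_pair (fun e he => h3 e (mem_filter.1 he).1) hov, mul_sum]
    have hterm : ∀ p ∈ ({w | w ≠ o ∧ w ≠ v ∧ {o, v, w} ∈ {e ∈ E | u ∉ e ∧ swap o u e ∉ E}} :
        Finset (Fin k)), ∏ i ∈ ({o, v, p} : Finset (Fin k)).erase o, x i = x v * x p := by
      intro p hp
      simp only [mem_filter, mem_univ, true_and] at hp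
      rw [erase_insert (by simp [hov, hp.1.symm]), prod_pair hp.2.1.symm]
    rw [sum_congr rfl hterm]
    refine sum_le_sum_of_subset_of_nonneg (fun p hp => ?_)
      fun _ _ _ => mul_nonneg (hx _) (hx _)
    simp only [mem_filter, mem_univ, true_and] at hp ⊢
    obtain ⟨hpo, hpv, hE, hu, hs⟩ := hp
    simp only [mem_insert, mem_singleton, not_or] at hu
    refine ⟨fun hc => hs ?_, Ne.symm hu.2.2, hpv⟩
    rw [swap, erase_insert (by simp [hov, hpo.symm])]
    exact (mem_codegSet.1 hc).2.2

end

/-! ### Edge counts when the two lightest vertices share an edge. -/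

section

variable {k m : ℕ} {E : Finset (Finset (Fin k))} {x : Fin k → ℝ} {o u v : Fin k}

lemma pow_le_prod {W : Type*} {f : Finset W} {x : W → ℝ} {c : ℝ} (hc : 0 ≤ c)
    (h : ∀ i ∈ f, c ≤ x i) : c ^ #f ≤ ∏ i ∈ f, x i := by
  rw [← prod_const]
  exact prod_le_prod (fun _ _ => hc) h

/-- An extremal shifted family in which the two lightest vertices lie in a common edge has at least
`(k - 1).choose 3` edges. -/
lemma IsExtremal.choose_le_card (h : IsExtremal m E x) (hpos : ∀ i, 0 < x i) (hanti : Antitone x)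
    (hS : Shifted E) (hk : 6 ≤ k) (ho : ∀ i, o ≤ i) (hv : ∀ i, i ≤ v) (hu : ∀ i, i ≠ v → i ≤ u)
    (hou : o ≠ u) (hov : o ≠ v) (huv : u ≠ v) (hcov : ∃ e ∈ E, u ∈ e ∧ v ∈ e) :
    (k - 1).choose 3 ≤ #E := by
  by_contra! hlt
  have hx : ∀ i, 0 ≤ x i := h.nonneg
  have h3 := h.card_eq
  set B := codegSet E u v with hB
  have hoB : o ∈ B := hS.mem_codegSet_of_exists h3 ho hou hov huv hcov
  have hvB : v ∉ B := fun hh => (mem_codegSet.1 hh).2.1 rfl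
  have huB : u ∉ B := fun hh => (mem_codegSet.1 hh).1 rfl
  have hb1 : 1 ≤ #B := card_pos.2 ⟨o, hoB⟩
  set g := #{e ∈ E | v ∈ e} with hg
  -- Every member of `B` has full codegree with `v`, and each edge at `v` is counted at most twice.
  have hbg : #B * (k - 2) ≤ 2 * g := by
    have h1 := sum_two_mul_degree h3 v B hvB
    have h2 : ∀ w ∈ B, #{e ∈ E | v ∈ e ∧ w ∈ e} = k - 2 := fun w hw => by
      rw [card_codeg h3 (ne_of_mem_of_not_mem hw hvB).symm, hS.codeg_eq huv hu hw]
    rwa [sum_congr rfl h2, sum_const, smul_eq_mul] at h1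
  have hmiss := degree_lt_card_missing hlt v
  set P := ∑ f ∈ missing E v with u ∈ f, ∏ i ∈ f.erase u, x i with hP
  set Q := ∑ p with p ∉ B ∧ p ≠ u ∧ p ≠ v, x p with hQ
  set R := ∑ w ∈ (univ.erase o).erase u, x w with hR
  -- Since `{o, u, v}` is an edge and `v` is last, shiftedness makes every `{o, u, w}` an edge.
  have hZ : pairWt E x o u = R := by
    rw [pairWt_eq h3 hou, hR]
    refine sum_congr ?_ fun _ _ => rfl
    ext w
    simp only [mem_filter, mem_univ, true_and, mem_erase, and_true]
    constructor
    · rintro ⟨h1, h2, -⟩; exact ⟨h2, h1⟩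
    · rintro ⟨h1, h2⟩
      refine ⟨h2, h1, ?_⟩
      have := (mem_codegSet.1 hoB).2.2
      rw [← triple_rotate] at this
      exact hS.triple_mem this hov huv h2 h1 (hv w)
  have hdiff : (x o - x u) * R ≤ P + x v * Q := by
    rw [← hZ, h.sub_mul_pairWt hou (hpos o) (hpos u)]
    have h1 := excessWt_le_missing (E := E) h3 hx hov huv
    have h2 := excessWt_nonneg (E := E) hx u o
    linarith
  have hQ0 : 0 ≤ Q := sum_nonneg fun _ _ => hx _
  have hP0 : 0 ≤ P := sum_nonneg fun _ _ => prod_nonneg fun _ _ => hx _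
  have hvmin : ∀ i, x v ≤ x i := fun i => hanti (hv i)
  -- Replacing `o` by `v` in `B` keeps its size; the result and the index set of `Q` partition the
  -- vertices other than `o` and `u`.
  have hRle : (#B : ℝ) * x v + Q ≤ R := by
    have hset : (univ.erase o).erase u =
        insert v (B.erase o) ∪ ({p | p ∉ B ∧ p ≠ u ∧ p ≠ v} : Finset (Fin k)) := by
      ext p
      simp only [mem_erase, mem_univ, and_true, mem_union, mem_insert, mem_filter, true_and]
      constructor
      · rintro ⟨h1, h2⟩
        by_cases hpv : p = v
        · exact Or.inl (Or.inl hpv)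
        by_cases hpB : p ∈ B
        · exact Or.inl (Or.inr ⟨h2, hpB⟩)
        · exact Or.inr ⟨hpB, h1, hpv⟩
      · rintro ((rfl | ⟨h1, h2⟩) | ⟨h1, h2, -⟩)
        · exact ⟨huv.symm, hov.symm⟩
        · exact ⟨fun hh => huB (hh ▸ h2), h1⟩
        · exact ⟨h2, fun hh => h1 (hh ▸ hoB)⟩
    have hdisj : Disjoint (insert v (B.erase o))
        ({p | p ∉ B ∧ p ≠ u ∧ p ≠ v} : Finset (Fin k)) := by
      rw [disjoint_left]
      intro p hp
      simp only [mem_insert, mem_erase, mem_filter, mem_univ, true_and] at hp ⊢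
      rintro ⟨h1, -, h2⟩
      rcases hp with hp | hp
      · exact h2 hp
      · exact h1 hp.2
    have hcard : #(insert v (B.erase o)) = #B := by
      rw [card_insert_of_notMem (fun hh => hvB (mem_of_mem_erase hh)), card_erase_add_one hoB]
    rw [hR, hset, sum_union hdisj, ← hcard, ← nsmul_eq_mul]
    gcongr
    exact card_nsmul_le_sum _ _ _ fun i _ => hvmin i
  have hkR : ((k : ℝ) - 2) * x v ≤ R := by
    have hcard : #((univ.erase o).erase u) = k - 2 := by
      rw [card_erase_of_mem (by simp [hou.symm]), card_erase_of_mem (mem_univ _), card_univ,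
        Fintype.card_fin]
      omega
    have := card_nsmul_le_sum ((univ.erase o).erase u) x (x v) fun i _ => hvmin i
    rw [hcard, nsmul_eq_mul, Nat.cast_sub (by omega)] at this
    exact_mod_cast this
  have hR0 : 0 < R := by
    have : (0 : ℝ) < #B * x v := mul_pos (by exact_mod_cast hb1) (hpos v)
    linarith
  set S := pairWt E x u v with hSdef
  have hSle : S ≤ #B * x o := by
    rw [hSdef, pairWt_eq h3 huv, ← nsmul_eq_mul]
    exact sum_le_card_nsmul _ _ _ fun i _ => hanti (ho i)
  -- The lightest weight outside `u, v` bounds below every vertex other than `u` of a missing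
  -- triple.
  obtain ⟨c', hc'⟩ : ∃ c' : Fin k, c' ∉ ({u, v} : Finset (Fin k)) ∧
      ∀ i, i ≠ u → i ≠ v → x c' ≤ x i := by
    have hne : ((univ : Finset (Fin k)) \ {u, v}).Nonempty := ⟨o, by simp [hou, hov]⟩
    obtain ⟨c', h1, h2⟩ := exists_min_image _ x hne
    exact ⟨c', (mem_sdiff.1 h1).2, fun i hiu hiv => h2 i (by simp [hiu, hiv])⟩
  set c := x c' with hcdef
  have huc : x u ≤ c := hanti (hu c' fun hh => hc'.1 (by simp [hh]))
  have hvu : x v ≤ x u := hvmin u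
  have hc0 : 0 < c := hpos c'
  set Nu := {f ∈ missing E v | u ∈ f} with hNu
  have hNuprop : ∀ f ∈ Nu, c ^ 2 ≤ ∏ i ∈ f.erase u, x i := by
    intro f hf
    obtain ⟨hfm, huf⟩ := mem_filter.1 hf
    obtain ⟨hf3, hvf, -⟩ := mem_missing.1 hfm
    have hcard : #(f.erase u) = 2 := by rw [card_erase_of_mem huf, hf3]
    rw [← hcard]
    refine pow_le_prod hc0.le fun i hi => hc'.2 i (ne_of_mem_erase hi) ?_
    rintro rfl
    exact hvf (mem_of_mem_erase hi)
  have hshiftNu : ∀ f ∈ Nu, ∏ i ∈ f, shift x u v (x v) i = (x u + x v) * ∏ i ∈ f.erase u, x i := by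
    intro f hf
    obtain ⟨hfm, huf⟩ := mem_filter.1 hf
    obtain ⟨-, hvf, -⟩ := mem_missing.1 hfm
    rw [← mul_prod_erase f _ huf, shift_left,
      prod_shift_of_notMem x _ (by simp) (fun hh => hvf (mem_of_mem_erase hh))]
  have hgain : ∀ F ⊆ missing E v, #F = g → wt F (shift x u v (x v)) ≤ x v ^ 2 * S :=
    fun F hF hFc => h.wt_le_of_missing hpos huv (fun f hf => (mem_missing.1 (hF hf)).1)
      (fun f hf => (mem_missing.1 (hF hf)).2.2) hFc.le
  have hbR : (1 : ℝ) ≤ #B := by exact_mod_cast hb1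
  have hkreal : (6 : ℝ) ≤ k := by exact_mod_cast hk
  have hbgR : (#B : ℝ) * ((k : ℝ) - 2) ≤ 2 * g := by
    have : ((#B * (k - 2) : ℕ) : ℝ) ≤ ((2 * g : ℕ) : ℝ) := by exact_mod_cast hbg
    push_cast [Nat.cast_sub (show 2 ≤ k by omega)] at this
    exact this
  -- Missing triples through `u` profit from its increased weight `x u + x v`. All of them are used
  -- if there are at most `g`; otherwise `g` of them with at least the average link product.
  rcases le_or_gt #Nu g with hle | hgt
  · obtain ⟨F, hNF, hFm, hFc⟩ := exists_subsuperset_card_eq (filter_subset _ _) hle hmiss.le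
    have hF := hgain F hFm hFc
    refine absurd hF (not_le.2 ?_)
    refine gain_of_few_missing (hpos v) hvu huc hbR hP0 hQ0 hR0 hdiff hRle hSle
      (g := g) (by nlinarith) ?_
    have hsplit : wt F (shift x u v (x v)) = ∑ f ∈ F \ Nu, ∏ i ∈ f, shift x u v (x v) i
        + ∑ f ∈ Nu, ∏ i ∈ f, shift x u v (x v) i := (sum_sdiff hNF).symm
    have hP2 : ∑ f ∈ Nu, ∏ i ∈ f, shift x u v (x v) i = (x u + x v) * P := by
      rw [sum_congr rfl hshiftNu, ← mul_sum]
    have hPc : (#Nu : ℝ) * c ^ 2 ≤ P := by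
      rw [← nsmul_eq_mul]
      exact card_nsmul_le_sum _ _ _ hNuprop
    have hrest : (#(F \ Nu) : ℝ) * (x u * c ^ 2) ≤
        ∑ f ∈ F \ Nu, ∏ i ∈ f, shift x u v (x v) i := by
      rw [← nsmul_eq_mul]
      refine card_nsmul_le_sum _ _ _ fun f hf => ?_
      obtain ⟨hfF, hfN⟩ := mem_sdiff.1 hf
      obtain ⟨hf3, hvf, -⟩ := mem_missing.1 (hFm hfF)
      have huf : u ∉ f := fun hh => hfN (mem_filter.2 ⟨hFm hfF, hh⟩)
      rw [prod_shift_of_notMem x _ huf hvf]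
      have h1 : c ^ 3 ≤ ∏ i ∈ f, x i := by
        rw [← hf3]
        refine pow_le_prod hc0.le fun i hi => hc'.2 i ?_ ?_
        · rintro rfl; exact huf hi
        · rintro rfl; exact hvf hi
      have h2 : x u * c ^ 2 ≤ c * c ^ 2 := mul_le_mul_of_nonneg_right huc (by positivity)
      calc x u * c ^ 2 ≤ c * c ^ 2 := h2
        _ = c ^ 3 := by ring
        _ ≤ _ := h1
    have hcount : (#(F \ Nu) : ℝ) + #Nu = g := by
      rw [← hFc]
      exact_mod_cast card_sdiff_add_card_eq_card hNF
    rw [hsplit, hP2, ← hcount]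
    nlinarith [mul_le_mul_of_nonneg_left hPc (hx u)]
  · obtain ⟨F, hFN, hFc, hFP⟩ := exists_subset_card_mul_sum_le
      (fun f : Finset (Fin k) => ∏ i ∈ f.erase u, x i) Nu hgt.le
    have hF := hgain F (hFN.trans (filter_subset _ _)) hFc
    set PF := ∑ f ∈ F, ∏ i ∈ f.erase u, x i with hPF
    have hwF : wt F (shift x u v (x v)) = (x u + x v) * PF := by
      rw [wt, sum_congr rfl fun f hf => hshiftNu f (hFN hf), ← mul_sum]
    have hcPF : (g : ℝ) * c ^ 2 ≤ PF := by
      rw [← hFc, ← nsmul_eq_mul]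
      exact card_nsmul_le_sum _ _ _ fun f hf => hNuprop f (hFN hf)
    have hPF0 : 0 ≤ PF := sum_nonneg fun _ _ => prod_nonneg fun _ _ => hx _
    have hν : #Nu ≤ (k - 2).choose 2 := by
      have hsub : Nu.image (fun f => f.erase u) ⊆ ((univ.erase v).erase u).powersetCard 2 := by
        intro s hs
        obtain ⟨f, hf, rfl⟩ := mem_image.1 hs
        obtain ⟨hfm, huf⟩ := mem_filter.1 hf
        obtain ⟨hf3, hvf, -⟩ := mem_missing.1 hfm
        refine mem_powersetCard.2 ⟨?_, by rw [card_erase_of_mem huf, hf3]⟩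
        exact erase_subset_erase u (subset_erase.2 ⟨subset_univ _, hvf⟩)
      have hinj : Set.InjOn (fun f : Finset (Fin k) => f.erase u) Nu := by
        intro f hf f' hf' hff
        rw [← insert_erase (mem_filter.1 hf).2, ← insert_erase (mem_filter.1 hf').2]
        exact congrArg (insert u) hff
      have := card_le_card hsub
      rwa [card_image_of_injOn hinj, card_powersetCard, card_erase_of_mem (by simp [huv]),
        card_erase_of_mem (mem_univ _), card_univ, Fintype.card_fin, Nat.sub_sub] at this
    have hνR : 2 * (#Nu : ℝ) ≤ ((k : ℝ) - 2) * (k - 3) := by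
      have h1 : (#Nu : ℝ) ≤ (((k - 2).choose 2 : ℕ) : ℝ) := by exact_mod_cast hν
      rw [Nat.cast_choose_two, Nat.cast_sub (show 2 ≤ k by omega)] at h1
      push_cast at h1
      linarith
    rw [hwF] at hF
    exact absurd hF (not_le.2 (gain_of_many_missing (hpos v) hvu huc hbR hR0 hkreal hPF0 hdiff hRle
      hSle hkR hνR hbgR hFP hcPF))

/-- A shifted family of triples that contains all triples avoiding the last vertex `v`, in which
the last two vertices lie in a common edge, and which has at most
`(k - 1).choose 3 + (k - 2).choose 2` edges, is not extremal. -/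
lemma IsExtremal.false_of_clique (h : IsExtremal m E x) (hpos : ∀ i, 0 < x i) (hanti : Antitone x)
    (hS : Shifted E) (ho : ∀ i, o ≤ i) (hv : ∀ i, i ≤ v) (hu : ∀ i, i ≠ v → i ≤ u)
    (hou : o ≠ u) (hov : o ≠ v) (huv : u ≠ v) (hcov : ∃ e ∈ E, u ∈ e ∧ v ∈ e)
    (hcl : (univ.erase v).powersetCard 3 ⊆ E)
    (hE : #E ≤ (k - 1).choose 3 + (k - 2).choose 2) : False := by
  have hx : ∀ i, 0 ≤ x i := h.nonneg
  have h3 := h.card_eq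
  have hcl' : ∀ f : Finset (Fin k), #f = 3 → v ∉ f → f ∈ E := fun f hf hvf =>
    hcl (mem_powersetCard.2 ⟨subset_erase.2 ⟨subset_univ _, hvf⟩, hf⟩)
  set B := codegSet E u v with hB
  have hoB : o ∈ B := hS.mem_codegSet_of_exists h3 ho hou hov huv hcov
  have hb1 : 1 ≤ #B := card_pos.2 ⟨o, hoB⟩
  have houv := (mem_codegSet.1 hoB).2.2
  have hvu : x v ≤ x u := hanti (hv u)
  -- all weights outside `v` are close to the largest one
  have hclose : ∀ p, p ≠ v → x o - x v < x p := by
    intro p hpv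
    by_cases hpo : p = o
    · rw [hpo]; linarith [hpos v]
    have hop : o ≠ p := Ne.symm hpo
    set T := ∑ w ∈ ((univ.erase v).erase o).erase p, x w with hT
    have hT0 : 0 ≤ T := sum_nonneg fun _ _ => hx _
    have hZ : pairWt E x o p = x v + T := by
      rw [pairWt_eq h3 hop, hT, ← sum_insert (by simp)]
      refine sum_congr ?_ fun _ _ => rfl
      ext w
      simp only [mem_filter, mem_univ, true_and, mem_insert, mem_erase, and_true]
      constructor
      · rintro ⟨h1, h2, -⟩
        by_cases hwv : w = v <;> simp [*]
      · rintro (rfl | ⟨h1, h2, h4⟩)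
        · refine ⟨hov.symm, hpv.symm, ?_⟩
          rw [triple_rotate] at houv
          have := hS.triple_mem houv huv.symm hou hpv hpo (hu p hpv)
          rwa [triple_rotate] at this
        · refine ⟨h2, h1, hcl' _ (card_eq_three.2 ⟨o, p, w, hop, Ne.symm h2, Ne.symm h1, rfl⟩) ?_⟩
          simp [hov.symm, Ne.symm hpv, Ne.symm h4]
    -- All triples avoiding `v` are present, so an edge at `o` that cannot be moved to `p` is some
    -- `{o, v, q}`. As `T < x v + T`, this forces `x o - x p < x v`.
    have hex : excessWt E x o p ≤ x v * T := by
      have hfil : ({e ∈ E | o ∈ e ∧ p ∉ e ∧ swap o p e ∉ E}) =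
          {e ∈ {e ∈ E | p ∉ e ∧ swap o p e ∉ E} | o ∈ e ∧ v ∈ e} := by
        ext e
        simp only [mem_filter]
        constructor
        · rintro ⟨h1, h2, h4, h5⟩
          refine ⟨⟨h1, h4, h5⟩, h2, ?_⟩
          by_contra hve
          refine h5 (hcl' _ (by rw [card_swap h2 h4, h3 e h1]) ?_)
          simp only [swap, mem_insert, mem_erase, not_or]
          exact ⟨hpv.symm, fun hh => hve hh.2⟩
        · tauto
      rw [excessWt, hfil, sum_edges_of_pair (fun e he => h3 e (mem_filter.1 he).1) hov, hT, mul_sum]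
      have hterm : ∀ q ∈ ({w | w ≠ o ∧ w ≠ v ∧ {o, v, w} ∈ {e ∈ E | p ∉ e ∧ swap o p e ∉ E}} :
          Finset (Fin k)), ∏ i ∈ ({o, v, q} : Finset (Fin k)).erase o, x i = x v * x q := by
        intro q hq
        simp only [mem_filter, mem_univ, true_and] at hq
        rw [erase_insert (by simp [hov, hq.1.symm]), prod_pair hq.2.1.symm]
      rw [sum_congr rfl hterm]
      refine sum_le_sum_of_subset_of_nonneg (fun q hq => ?_)
        fun _ _ _ => mul_nonneg (hx _) (hx _)
      simp only [mem_filter, mem_univ, true_and, mem_erase, and_true] at hq ⊢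
      obtain ⟨hqo, hqv, -, hpq, -⟩ := hq
      simp only [mem_insert, mem_singleton, not_or] at hpq
      exact ⟨Ne.symm hpq.2.2, hqo, hqv⟩
    have hid := h.sub_mul_pairWt hop (hpos o) (hpos p)
    have hex' := excessWt_nonneg (E := E) hx p o
    rw [hZ] at hid
    have hvp := hpos v
    by_contra! hcon
    nlinarith [mul_le_mul_of_nonneg_right (show x v ≤ x o - x p by linarith)
      (show 0 ≤ x v + T by linarith), mul_pos hvp hvp]
  -- the triples at `u` that cannot be moved to `v`
  set D := {e ∈ E | u ∈ e ∧ v ∉ e ∧ swap u v e ∉ E} with hD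
  -- Each of the `(k - 2).choose 2` pairs avoiding `u, v` extends by `v` to an edge or by `u` to a
  -- member of `D`. The edge bound gives `v` degree at most `(k - 2).choose 2`, and `#B` of the
  -- edges at `v` contain `u`.
  have hDcard : #B ≤ #D := by
    have hsplit : #{e ∈ E | v ∉ e} = (k - 1).choose 3 := by
      have : {e ∈ E | v ∉ e} = (univ.erase v).powersetCard 3 := by
        ext e
        simp only [mem_filter, mem_powersetCard, subset_erase, subset_univ, true_and]
        exact ⟨fun hh => ⟨hh.2, h3 e hh.1⟩, fun hh => ⟨hcl' e hh.2 hh.1, hh.1⟩⟩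
      rw [this, card_powersetCard, card_erase_of_mem (mem_univ _), card_univ, Fintype.card_fin]
    have hdeg : #{e ∈ E | v ∈ e} ≤ (k - 2).choose 2 := by
      have := card_filter_add_card_filter_not (s := E) (fun e => v ∈ e)
      omega
    have hdeg2 : #{e ∈ E | v ∈ e} = #B + #{e ∈ E | v ∈ e ∧ u ∉ e} := by
      rw [hB, ← card_codeg h3 huv, ← card_filter_add_card_filter_not (s := {e ∈ E | v ∈ e})
        (fun e => u ∈ e), filter_filter, filter_filter]
      congr 2
      ext e; simp only [mem_filter]; tauto
    have hpairs : (k - 2).choose 2 ≤ #D + #{e ∈ E | v ∈ e ∧ u ∉ e} := by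
      have hcard : #(((univ.erase v).erase u).powersetCard 2) = (k - 2).choose 2 := by
        rw [card_powersetCard, card_erase_of_mem (by simp [huv]), card_erase_of_mem (mem_univ _),
          card_univ, Fintype.card_fin, Nat.sub_sub]
      rw [← hcard]
      have hsub : ((univ.erase v).erase u).powersetCard 2 ⊆
          D.image (fun e => e.erase u) ∪ {e ∈ E | v ∈ e ∧ u ∉ e}.image (fun e => e.erase v) := by
        intro s hs
        rw [mem_powersetCard, subset_erase, subset_erase] at hs
        obtain ⟨⟨⟨-, hvs⟩, hus⟩, hs2⟩ := hs
        have hins : (insert u s).erase u = s := erase_insert hus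
        rw [mem_union, mem_image, mem_image]
        by_cases hm : insert v s ∈ E
        · right
          refine ⟨insert v s, mem_filter.2 ⟨hm, by simp, by simp [huv, hus]⟩, erase_insert hvs⟩
        · left
          refine ⟨insert u s, mem_filter.2 ⟨hcl' _ (by rw [card_insert_of_notMem hus, hs2])
            (by simp [huv.symm, hvs]), by simp, by simp [huv.symm, hvs], ?_⟩, hins⟩
          rwa [swap, hins]
      exact (card_le_card hsub).trans ((card_union_le _ _).trans
        (add_le_add card_image_le card_image_le))
    omega
  have hexv : excessWt E x v u = 0 := by
    refine sum_eq_zero fun e he => absurd ?_ (mem_filter.1 he).2.2.2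
    obtain ⟨heE, hve, hue, -⟩ := mem_filter.1 he
    exact hcl' _ (by rw [card_swap hve hue, h3 e heE]) (notMem_swap huv.symm)
  have hid := h.sub_mul_pairWt huv (hpos u) (hpos v)
  rw [hexv, sub_zero] at hid
  have hSle : pairWt E x u v ≤ #B * x o := by
    rw [pairWt_eq h3 huv, ← nsmul_eq_mul]
    exact sum_le_card_nsmul _ _ _ fun i _ => hanti (ho i)
  -- The chain is `x p * x q ≥ x p * x u > (x o - x v) * x u ≥ (x u - x v) * x o`. Summed over `D`,
  -- it exceeds the left side of `hid`.
  have hDterm : ∀ e ∈ D, (x u - x v) * x o < ∏ i ∈ e.erase u, x i := by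
    intro e he
    obtain ⟨heE, hue, hve, -⟩ := mem_filter.1 he
    have hcard : #(e.erase u) = 2 := by rw [card_erase_of_mem hue, h3 e heE]
    obtain ⟨p, q, hpq, hepq⟩ := card_eq_two.1 hcard
    have hp : p ∈ e.erase u := by simp [hepq]
    have hq : q ∈ e.erase u := by simp [hepq]
    have hpv : p ≠ v := fun hh => hve (hh ▸ mem_of_mem_erase hp)
    have hqv : q ≠ v := fun hh => hve (hh ▸ mem_of_mem_erase hq)
    rw [hepq, prod_pair hpq]
    have h1 := hclose p hpv
    have h2 : x u ≤ x q := hanti (hu q hqv)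
    have h4 : x u ≤ x o := hanti (ho u)
    have h5 : x p * x u ≤ x p * x q := mul_le_mul_of_nonneg_left h2 (hx p)
    have h6 : (x o - x v) * x u < x p * x u := mul_lt_mul_of_pos_right h1 (hpos u)
    nlinarith [mul_le_mul_of_nonneg_left h4 (hx v)]
  have hDne : D.Nonempty := card_pos.1 (by omega)
  have hsum : (#D : ℝ) * ((x u - x v) * x o) < excessWt E x u v := by
    rw [← nsmul_eq_mul, ← sum_const, excessWt]
    exact sum_lt_sum_of_nonempty hDne hDterm
  have hnn : 0 ≤ (x u - x v) * x o := mul_nonneg (by linarith) (hx o)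
  have hBD : (#B : ℝ) * ((x u - x v) * x o) ≤ #D * ((x u - x v) * x o) :=
    mul_le_mul_of_nonneg_right (by exact_mod_cast hDcard) hnn
  nlinarith [mul_le_mul_of_nonneg_left hSle (show 0 ≤ x u - x v by linarith)]

end

/-! ### Restricting extremal pairs to the support. -/

section Transport

variable {V W : Type*} [DecidableEq V] [Fintype V] [DecidableEq W] [Fintype W]

/-- The trace of a family of sets along an embedding. -/
def traceFamily (ι : W ↪ V) (E : Finset (Finset V)) : Finset (Finset W) := {f | f.map ι ∈ E}

lemma mem_traceFamily {ι : W ↪ V} {E : Finset (Finset V)} {f : Finset W} :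
    f ∈ traceFamily ι E ↔ f.map ι ∈ E := by simp [traceFamily]

lemma exists_map_eq {ι : W ↪ V} {e : Finset V} (h : ∀ i ∈ e, i ∈ Set.range ι) :
    ∃ f : Finset W, f.map ι = e := by
  refine ⟨univ.filter fun w => ι w ∈ e, ?_⟩
  ext i
  simp only [mem_map, mem_filter, mem_univ, true_and]
  constructor
  · rintro ⟨w, hw, rfl⟩; exact hw
  · intro hi
    obtain ⟨w, rfl⟩ := h i hi
    exact ⟨w, hi, rfl⟩

lemma wt_traceFamily (ι : W ↪ V) (E : Finset (Finset V)) {x : V → ℝ}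
    (hx : ∀ i, i ∉ Set.range ι → x i = 0) : wt (traceFamily ι E) (x ∘ ι) = wt E x := by
  have h1 : wt (traceFamily ι E) (x ∘ ι) =
      ∑ e ∈ (traceFamily ι E).map (mapEmbedding ι).toEmbedding, ∏ i ∈ e, x i := by
    rw [sum_map]
    refine sum_congr rfl fun f _ => ?_
    simp [mapEmbedding_apply]
  rw [h1, wt]
  refine sum_subset (fun e he => ?_) fun e heE he => ?_
  · obtain ⟨f, hf, rfl⟩ := mem_map.1 he
    exact mem_traceFamily.1 hf
  · by_contra hne
    have hr : ∀ i ∈ e, i ∈ Set.range ι := fun i hi => by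
      by_contra hir
      exact hne (prod_eq_zero hi (hx i hir))
    obtain ⟨f, rfl⟩ := exists_map_eq hr
    exact he (mem_map.2 ⟨f, mem_traceFamily.2 heE, rfl⟩)

lemma sum_comp_embedding (ι : W ↪ V) {x : V → ℝ} (hx : ∀ i, i ∉ Set.range ι → x i = 0) :
    ∑ w, x (ι w) = ∑ i, x i := by
  rw [← sum_map univ ι x]
  refine sum_subset (subset_univ _) fun i _ hi => hx i ?_
  rintro ⟨w, rfl⟩
  exact hi (by simp)

/-- Any competitor on `W` pushes forward to `V`, with weights extended by zero, and keeps its value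
and its number of edges. -/
lemma IsExtremal.pullback {m : ℕ} {E : Finset (Finset V)} {x : V → ℝ} (h : IsExtremal m E x)
    (ι : W ↪ V) (hx : ∀ i, i ∉ Set.range ι → x i = 0) :
    IsExtremal m (traceFamily ι E) (x ∘ ι) where
  card_eq f hf := by rw [← card_map ι, h.card_eq _ (mem_traceFamily.1 hf)]
  card_le := by
    rw [← card_map (mapEmbedding ι).toEmbedding]
    refine (card_le_card fun e he => ?_).trans h.card_le
    obtain ⟨f, hf, rfl⟩ := mem_map.1 he
    exact mem_traceFamily.1 hf
  mem := ⟨fun w => h.nonneg _, by simpa using (sum_comp_embedding ι hx).trans h.mem.2⟩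
  wt_le E' h3 hc y hy := by
    set x' : V → ℝ := Function.extend ι y 0 with hx'
    have hx'0 : ∀ i, i ∉ Set.range ι → x' i = 0 := fun i hi => by
      rw [hx', Function.extend_apply' _ _ _ (by simpa using hi)]; rfl
    have hx'ι : x' ∘ ι = y := Function.extend_comp ι.injective y 0
    have hx'w : ∀ w, x' (ι w) = y w := fun w => congrFun hx'ι w
    have hpull : traceFamily ι (E'.map (mapEmbedding ι).toEmbedding) = E' := by
      ext f
      rw [mem_traceFamily, mem_map]
      constructor
      · rintro ⟨f', hf', hff⟩
        have : f' = f := map_injective ι hff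
        exact this ▸ hf'
      · intro hf; exact ⟨f, hf, rfl⟩
    have hmax := h.wt_le (E'.map (mapEmbedding ι).toEmbedding) (by
      intro e he
      obtain ⟨f, hf, rfl⟩ := mem_map.1 he
      exact (card_map ι).trans (h3 f hf)) (by rwa [card_map]) x' ⟨fun i => by
        by_cases hi : i ∈ Set.range ι
        · obtain ⟨w, rfl⟩ := hi
          rw [hx'w]; exact hy.1 w
        · rw [hx'0 i hi], by
        rw [← sum_comp_embedding ι hx'0, ← hy.2]
        exact sum_congr rfl fun w _ => hx'w w⟩
    rw [← wt_traceFamily ι _ hx'0, hpull, hx'ι] at hmax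
    rwa [wt_traceFamily ι E hx]

/-- An enumeration of the support of `x` by decreasing weight. -/
lemma exists_embedding_antitone (x : V → ℝ) (hx : ∀ i, 0 ≤ x i) {k : ℕ}
    (hk : #{i | 0 < x i} = k) :
    ∃ ι : Fin k ↪ V, Antitone (x ∘ ι) ∧ (∀ w, 0 < x (ι w)) ∧ ∀ i, i ∉ Set.range ι → x i = 0 := by
  let P : Finset V := {i | 0 < x i}
  let ε : P ≃ Fin k := P.equivFinOfCardEq hk
  let f : Fin k → ℝ := fun w => -x (ε.symm w)
  let ι : Fin k ↪ V := ⟨fun w => ε.symm (Tuple.sort f w), fun a b hab =>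
    (Tuple.sort f).injective (ε.symm.injective (Subtype.ext hab))⟩
  refine ⟨ι, fun a b hab => ?_, fun w => ?_, fun i hi => ?_⟩
  · have := Tuple.monotone_sort f hab
    exact neg_le_neg_iff.1 this
  · exact (mem_filter.1 (ε.symm (Tuple.sort f w)).2).2
  · by_contra hne
    have hiP : i ∈ P := by simpa [P] using lt_of_le_of_ne (hx i) (Ne.symm hne)
    refine hi ⟨(Tuple.sort f).symm (ε ⟨i, hiP⟩), ?_⟩
    change (ε.symm (Tuple.sort f ((Tuple.sort f).symm (ε ⟨i, hiP⟩))) : V) = i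
    rw [Equiv.apply_symm_apply, Equiv.symm_apply_apply]

end Transport

/-! ### Passing from families on `Fin k` to 3-graphs on {1, …, k}. -/

section Graphs

/-- The embedding of `Fin k` onto `{1, …, k}`. -/
def succEmb (k : ℕ) : Fin k ↪ ℕ := ⟨fun i => i + 1, fun i j h => Fin.ext (by simpa using h)⟩

lemma succEmb_apply {k : ℕ} (i : Fin k) : succEmb k i = i + 1 := rfl

lemma map_succEmb_univ (k : ℕ) : (univ : Finset (Fin k)).map (succEmb k) = Icc 1 k := by
  ext i
  simp only [mem_map, mem_univ, true_and, mem_Icc, succEmb_apply]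
  constructor
  · rintro ⟨a, rfl⟩; have := a.2; omega
  · rintro ⟨h1, h2⟩; exact ⟨⟨i - 1, by omega⟩, by simp; omega⟩

/-- A family of triples of `Fin k` as a `3`-graph on `{1, …, k}`. -/
def toGraph {k : ℕ} (E : Finset (Finset (Fin k))) (h3 : ∀ e ∈ E, #e = 3) : RGraph 3 ℕ where
  verts := Icc 1 k
  edges := E.map (mapEmbedding (succEmb k)).toEmbedding
  edges_sub := by
    intro e he
    obtain ⟨f, hf, rfl⟩ := mem_map.1 he
    refine mem_powersetCard.2 ⟨?_, (card_map _).trans (h3 f hf)⟩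
    rw [← map_succEmb_univ]
    exact map_subset_map.2 (subset_univ f)

lemma map_mem_toGraph {k : ℕ} {E : Finset (Finset (Fin k))} {h3 : ∀ e ∈ E, #e = 3}
    {f : Finset (Fin k)} : f.map (succEmb k) ∈ (toGraph E h3).edges ↔ f ∈ E := by
  simp only [toGraph, mem_map, RelEmbedding.coe_toEmbedding, mapEmbedding_apply]
  constructor
  · rintro ⟨f', hf', hff⟩
    exact map_injective _ hff ▸ hf'
  · intro hf; exact ⟨f, hf, rfl⟩

lemma bddAbove_weightPoly {r : ℕ} {α : Type*} (G : RGraph r α) :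
    BddAbove (G.weightPoly '' G.weightings) := by
  refine ⟨#G.edges, ?_⟩
  rintro _ ⟨y, hy, rfl⟩
  rw [RGraph.weightPoly, card_eq_sum_ones, Nat.cast_sum]
  refine sum_le_sum fun e he => ?_
  have hsub := (mem_powersetCard.1 (G.edges_sub he)).1
  rw [Nat.cast_one]
  refine prod_le_one (fun i hi => hy.1 i (hsub hi)) fun i hi => ?_
  rw [← hy.2]
  exact single_le_sum (fun j hj => hy.1 j hj) (hsub hi)

lemma wt_le_lagrangian {k : ℕ} {E : Finset (Finset (Fin k))} (h3 : ∀ e ∈ E, #e = 3)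
    {x : Fin k → ℝ} (hx : x ∈ stdSimplex ℝ (Fin k)) : wt E x ≤ (toGraph E h3).lagrangian := by
  set y : ℕ → ℝ := Function.extend (succEmb k) x 0 with hy
  have hyx : ∀ i, y (succEmb k i) = x i := fun i => (succEmb k).injective.extend_apply x 0 i
  refine le_csSup (bddAbove_weightPoly _) ⟨y, ⟨?_, ?_⟩, ?_⟩
  · intro i hi
    change i ∈ Icc 1 k at hi
    rw [← map_succEmb_univ] at hi
    obtain ⟨j, -, rfl⟩ := mem_map.1 hi
    rw [hyx]; exact hx.1 j
  · change ∑ i ∈ Icc 1 k, y i = 1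
    rw [← map_succEmb_univ, sum_map, ← hx.2]
    exact sum_congr rfl fun i _ => hyx i
  · rw [RGraph.weightPoly, toGraph, sum_map, wt]
    refine sum_congr rfl fun e _ => ?_
    simp [mapEmbedding_apply, hyx]

lemma initial_eq_toGraph (k : ℕ) : RGraph.initial 3 k =
    toGraph ((univ : Finset (Fin k)).powersetCard 3) fun _ he => (mem_powersetCard.1 he).2 := by
  simp only [RGraph.initial, RGraph.complete, toGraph, RGraph.mk.injEq, true_and]
  rw [← map_succEmb_univ, powersetCard_map]

lemma lagrangian_initial_pos {k : ℕ} (hk : 3 ≤ k) : 0 < (RGraph.initial 3 k).lagrangian := by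
  rw [initial_eq_toGraph]
  have hk0 : (0 : ℝ) < k := by exact_mod_cast (by omega : 0 < k)
  refine lt_of_lt_of_le ?_ (wt_le_lagrangian (x := fun _ => (k : ℝ)⁻¹) _
    ⟨fun _ => by positivity, by simp [hk0.ne']⟩)
  refine sum_pos (fun e _ => prod_pos fun _ _ => by positivity) ?_
  rw [powersetCard_nonempty]
  simpa using hk

lemma toGraph_leftCompressed {k : ℕ} {E : Finset (Finset (Fin k))} (h3 : ∀ e ∈ E, #e = 3)
    (hS : Shifted E) : (toGraph E h3).LeftCompressed := by
  intro i j hi hj hiv hij hjE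
  have hlift : ∀ n ∈ Icc 1 k, ∃ a : Fin k, succEmb k a = n := fun n hn => by
    rw [← map_succEmb_univ] at hn
    obtain ⟨a, -, ha⟩ := mem_map.1 hn
    exact ⟨a, ha⟩
  have hjv : ∀ p, j p ∈ Icc 1 k := fun p =>
    (mem_powersetCard.1 ((toGraph E h3).edges_sub hjE)).1 (by simp)
  choose I hI using fun p => hlift (i p) (hiv p)
  choose J hJ using fun p => hlift (j p) (hjv p)
  have himg : ∀ (n : Fin 3 → ℕ) (A : Fin 3 → Fin k), (∀ p, succEmb k (A p) = n p) →
      univ.image n = ({A 0, A 1, A 2} : Finset (Fin k)).map (succEmb k) := by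
    intro n A hA
    ext a
    simp only [mem_image, mem_univ, true_and, mem_map, mem_insert, mem_singleton, Fin.exists_fin_succ,
      ← hA]
    simp [eq_comm]
  rw [himg j J hJ, map_mem_toGraph] at hjE
  rw [himg i I hI, map_mem_toGraph]
  have hval : ∀ p, (I p : ℕ) + 1 = i p := fun p => hI p
  have hvalJ : ∀ p, (J p : ℕ) + 1 = j p := fun p => hJ p
  have i01 := hi (show (0 : Fin 3) < 1 by decide)
  have i12 := hi (show (1 : Fin 3) < 2 by decide)
  have j01 := hj (show (0 : Fin 3) < 1 by decide)
  have j12 := hj (show (1 : Fin 3) < 2 by decide)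
  have a0 := hij 0
  have a1 := hij 1
  have a2 := hij 2
  have := hval 0
  have := hval 1
  have := hval 2
  have := hvalJ 0
  have := hvalJ 1
  have := hvalJ 2
  have ne : ∀ {a b : Fin k}, (a : ℕ) ≠ b → a ≠ b := fun h hh => h (congrArg _ hh)
  -- The entries are lowered from the smallest to the largest, which keeps the three vertices
  -- distinct at every stage.
  rw [triple_rotate] at hjE
  have h1 : {J 1, J 2, I 0} ∈ E := hS.triple_mem hjE (ne (by omega)) (ne (by omega))
    (ne (by omega)) (ne (by omega)) (Fin.le_def.2 (by omega))
  rw [triple_rotate] at h1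
  have h2 : {J 2, I 0, I 1} ∈ E := hS.triple_mem h1 (ne (by omega)) (ne (by omega))
    (ne (by omega)) (ne (by omega)) (Fin.le_def.2 (by omega))
  rw [triple_rotate] at h2
  exact hS.triple_mem h2 (ne (by omega)) (ne (by omega))
    (ne (by omega)) (ne (by omega)) (Fin.le_def.2 (by omega))

end Graphs

/-! ### Assembling the cases. -/

lemma choose_add_choose_lt {l : ℕ} (hl : 5 ≤ l) :
    (l - 1).choose 3 + (l - 2).choose 2 < l.choose 3 := by
  obtain ⟨q, rfl⟩ : ∃ q, l = q + 2 := ⟨l - 2, by omega⟩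
  have h1 : (q + 2).choose 3 = (q + 1).choose 2 + (q + 1).choose 3 := Nat.choose_succ_succ' _ _
  have h2 : (q + 1).choose 2 = q.choose 1 + q.choose 2 := Nat.choose_succ_succ' _ _
  rw [Nat.choose_one_right] at h2
  simp only [Nat.add_sub_cancel, show q + 2 - 1 = q + 1 by omega]
  omega

/-- If an extremal pair reaches the Lagrangian of the complete graph on `l - 1` vertices, then the
support of the weighting is a clique of order `l - 1`. -/
lemma IsExtremal.clique_of_le {V : Type*} [DecidableEq V] [Fintype V] {l : ℕ} (hl : 5 ≤ l)
    (hcheck : ∀ G : RGraph 3 ℕ, G.verts = Finset.Icc 1 l → G.LeftCompressed →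
      G.edges.card = (l - 1).choose 3 + (l - 2).choose 2 →
      ¬ (RGraph.initial 3 (l - 1)).IsSubgraph G →
      G.lagrangian < (RGraph.initial 3 (l - 1)).lagrangian)
    {E : Finset (Finset V)} {x : V → ℝ}
    (h : IsExtremal ((l - 1).choose 3 + (l - 2).choose 2) E x) (hcov : PairCovered E x)
    (hV : l ≤ Fintype.card V) (hle : (RGraph.initial 3 (l - 1)).lagrangian ≤ wt E x) :
    wt E x ≤ (RGraph.initial 3 (l - 1)).lagrangian ∧
      ∃ T : Finset V, #T = l - 1 ∧ T.powersetCard 3 ⊆ E := by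
  have hpos := lagrangian_initial_pos (k := l - 1) (by omega)
  have hsupp := h.le_card_support (n := l - 1) (Nat.le_add_right _ _) (by omega)
    (hpos.trans_le hle)
  obtain ⟨k, hk⟩ : ∃ k, #{i | 0 < x i} = k := ⟨_, rfl⟩
  rw [hk] at hsupp
  obtain ⟨ι, hanti, hιpos, hι0⟩ := exists_embedding_antitone x h.nonneg hk
  have hE' := h.pullback ι hι0
  have hw' := wt_traceFamily ι E hι0
  rcases hsupp.eq_or_lt with hkl | hkl
  · subst hkl
    have hinit : wt (univ.powersetCard 3) (x ∘ ι) ≤ (RGraph.initial 3 (l - 1)).lagrangian := by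
      rw [initial_eq_toGraph]; exact wt_le_lagrangian _ hE'.mem
    have hsub : traceFamily ι E ⊆ univ.powersetCard 3 := fun e he =>
      mem_powersetCard.2 ⟨subset_univ _, hE'.card_eq e he⟩
    refine ⟨by rw [← hw']; exact (wt_mono hsub hE'.nonneg).trans hinit,
      univ.map ι, by simp, ?_⟩
    have heq : traceFamily ι E = univ.powersetCard 3 := by
      by_contra hne
      obtain ⟨f, hf, hfE⟩ := exists_of_ssubset (hsub.ssubset_of_ne hne)
      have : wt (traceFamily ι E) (x ∘ ι) < wt (univ.powersetCard 3) (x ∘ ι) :=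
        sum_lt_sum_of_subset hsub hf hfE (prod_pos fun i _ => hιpos i)
          fun _ _ _ => prod_nonneg fun i _ => hE'.nonneg i
      linarith
    rw [powersetCard_map]
    intro e he
    obtain ⟨f, hf, rfl⟩ := mem_map.1 he
    rw [← heq] at hf
    exact mem_traceFamily.1 hf
  · exfalso
    set u : Fin k := ⟨k - 2, by omega⟩ with hudef
    set v : Fin k := ⟨k - 1, by omega⟩ with hvdef
    set o : Fin k := ⟨0, by omega⟩ with hodef
    have huv : u ≠ v := by simp only [hudef, hvdef, ne_eq, Fin.mk.injEq]; omega
    have hou : o ≠ u := by simp only [hudef, hodef, ne_eq, Fin.mk.injEq]; omega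
    have hov : o ≠ v := by simp only [hodef, hvdef, ne_eq, Fin.mk.injEq]; omega
    have ho : ∀ i, o ≤ i := fun i => Fin.le_def.2 (Nat.zero_le _)
    have hv : ∀ i, i ≤ v := fun i => Fin.le_def.2 (by have := i.2; simp only [hvdef]; omega)
    have hu : ∀ i, i ≠ v → i ≤ u := fun i hi => by
      have h1 := i.2
      have h2 : (i : ℕ) ≠ k - 1 := fun hh => hi (Fin.ext hh)
      exact Fin.le_def.2 (by simp only [hudef]; omega)
    have hcov' : ∃ e ∈ traceFamily ι E, u ∈ e ∧ v ∈ e := by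
      obtain ⟨e, he, hue, hve, hepos⟩ := hcov (ι u) (ι v) (fun hh => huv (ι.injective hh))
        (hιpos u) (hιpos v)
      obtain ⟨f, rfl⟩ := exists_map_eq (ι := ι) (e := e) fun i hi => by
        by_contra hir
        exact (hepos i hi).ne' (hι0 i hir)
      exact ⟨f, mem_traceFamily.2 he, by simpa using hue, by simpa using hve⟩
    obtain ⟨E', hext, hwE', hS, hcE'⟩ := hE'.exists_shifted_pair hιpos hanti huv hcov'
    have hlt := choose_add_choose_lt hl
    have hkl' : l ≤ k := by omega
    rcases hkl'.eq_or_lt with rfl | hlk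
    -- Here k = l. `hcheck` speaks only of an exact number of edges, which extremality with positive
    -- weights provides.
    · have hcard := hext.card_eq_of_lt hιpos (by rwa [Fintype.card_fin])
      by_cases hcl : (univ.erase v).powersetCard 3 ⊆ E'
      · exact hext.false_of_clique hιpos hanti hS ho hv hu hou hov huv hcE' hcl hcard.le
      · have hnot : ¬ (RGraph.initial 3 (l - 1)).IsSubgraph (toGraph E' hext.card_eq) := by
          rintro ⟨-, hsub⟩
          refine hcl fun f hf => ?_
          rw [mem_powersetCard, subset_erase] at hf
          rw [← map_mem_toGraph (h3 := hext.card_eq)]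
          refine hsub (mem_powersetCard.2 ⟨fun a ha => ?_, by rw [card_map, hf.2]⟩)
          obtain ⟨i, hi, rfl⟩ := mem_map.1 ha
          have h2 : (i : ℕ) ≠ l - 1 := fun hh => hf.1.2 ((Fin.ext hh : i = v) ▸ hi)
          have h1 := i.2
          rw [mem_Icc, succEmb_apply]
          omega
        have hlam := hcheck (toGraph E' hext.card_eq) rfl (toGraph_leftCompressed _ hS)
          ((card_map _).trans hcard) hnot
        have := wt_le_lagrangian hext.card_eq hext.mem
        linarith
    · have h1 := hext.choose_le_card hιpos hanti hS (by omega) ho hv hu hou hov huv hcE'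
      have h2 := hext.card_le
      have h3 : l.choose 3 ≤ (k - 1).choose 3 := Nat.choose_le_choose 3 (by omega)
      omega

/-- A clique-free family with at most `(l - 1).choose 3 + (l - 2).choose 2` triples stays below the
Lagrangian of the complete graph on `l - 1` vertices. -/
lemma wt_lt_of_no_clique {V : Type*} [DecidableEq V] [Fintype V] {l : ℕ} (hl : 5 ≤ l)
    (hcheck : ∀ G : RGraph 3 ℕ, G.verts = Finset.Icc 1 l → G.LeftCompressed →
      G.edges.card = (l - 1).choose 3 + (l - 2).choose 2 →
      ¬ (RGraph.initial 3 (l - 1)).IsSubgraph G →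
      G.lagrangian < (RGraph.initial 3 (l - 1)).lagrangian)
    (hV : l ≤ Fintype.card V) {E : Finset (Finset V)} (h3 : ∀ e ∈ E, #e = 3)
    (hE : #E ≤ (l - 1).choose 3 + (l - 2).choose 2)
    (hcl : ¬ ∃ T : Finset V, #T = l - 1 ∧ T.powersetCard 3 ⊆ E) {x : V → ℝ}
    (hx : x ∈ stdSimplex ℝ V) : wt E x < (RGraph.initial 3 (l - 1)).lagrangian := by
  by_contra! hle
  have : Nonempty V := Fintype.card_pos_iff.1 (by omega)
  obtain ⟨E₁, x₁, h₁⟩ := exists_isExtremal (V := V) ((l - 1).choose 3 + (l - 2).choose 2)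
  obtain ⟨x₂, h₂, hw₂, hc₂⟩ := h₁.exists_pairCovered
  have hle₂ := h₂.wt_le E h3 hE x hx
  -- This use only bounds the maximum. It makes `E` itself extremal, and the second use then finds
  -- the clique inside `E`.
  have hmax := (h₂.clique_of_le hl hcheck hc₂ hV (hle.trans hle₂)).1
  have hext := h₂.of_wt_eq h3 hE hx (hmax.trans hle)
  obtain ⟨x₃, h₃, hw₃, hc₃⟩ := hext.exists_pairCovered
  exact hcl (h₃.clique_of_le hl hcheck hc₃ hV (by rw [hw₃]; exact hle)).2

/-- Weights are pushed forward along `φ`, whose fibres in the vertex set have at most one element.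
The assumption `hc` covers a graph without weightings, where the supremum is 0. -/
lemma lagrangian_le_of_relabel {r N : ℕ} {α : Type*} (G : RGraph r α) {φ : α → Fin N}
    (hφ : Set.InjOn φ G.verts) {c : ℝ} (hc : 0 ≤ c)
    (h : ∀ x ∈ stdSimplex ℝ (Fin N), wt (G.edges.image fun e => e.image φ) x ≤ c) :
    G.lagrangian ≤ c := by
  classical
  refine Real.sSup_le ?_ hc
  rintro _ ⟨y, hy, rfl⟩
  set x : Fin N → ℝ := fun i => ∑ a ∈ G.verts with φ a = i, y a with hx
  have hxφ : ∀ a ∈ G.verts, x (φ a) = y a := by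
    intro a ha
    have : {b ∈ G.verts | φ b = φ a} = {a} := by
      ext b
      simp only [mem_filter, mem_singleton]
      exact ⟨fun hb => hφ hb.1 ha hb.2, by rintro rfl; exact ⟨ha, rfl⟩⟩
    rw [hx]
    simp only [this, sum_singleton]
  have hsub : ∀ e ∈ G.edges, e ⊆ G.verts := fun e he => (mem_powersetCard.1 (G.edges_sub he)).1
  have hmem : x ∈ stdSimplex ℝ (Fin N) := by
    refine ⟨fun i => sum_nonneg fun a ha => hy.1 a (mem_filter.1 ha).1, ?_⟩
    rw [hx, sum_fiberwise, hy.2]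
  have hw : wt (G.edges.image fun e => e.image φ) x = G.weightPoly y := by
    rw [wt, sum_image, RGraph.weightPoly]
    · refine sum_congr rfl fun e he => ?_
      rw [prod_image (hφ.mono (by exact_mod_cast hsub e he))]
      exact prod_congr rfl fun a ha => hxφ a (hsub e he ha)
    · intro e he e' he' hee
      exact image_injOn_powerset_of_injOn hφ (by simpa using hsub e he)
        (by simpa using hsub e' he') hee
  rw [← hw]
  exact h x hmem

end TripleSystem

theorem theorem1p9 (l : ℕ)
    (hcheck : ∀ G : RGraph 3 ℕ, G.verts = Finset.Icc 1 l → G.LeftCompressed →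
      G.edges.card = (l - 1).choose 3 + (l - 2).choose 2 →
      ¬ (RGraph.initial 3 (l - 1)).IsSubgraph G →
      G.lagrangian < (RGraph.initial 3 (l - 1)).lagrangian)
    {α : Type u} (m : ℕ) (hm : 0 < m)
    (hlow : (l - 1).choose 3 ≤ m) (hupp : m ≤ (l - 1).choose 3 + (l - 2).choose 2)
    (G : RGraph 3 α) (hcard : G.edges.card = m) (hclique : ¬ G.HasClique (l - 1)) :
    G.lagrangian < (RGraph.initial 3 (l - 1)).lagrangian := by
  classical
  obtain ⟨e₀, he₀⟩ : G.edges.Nonempty := Finset.card_pos.1 (by omega)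
  have hsub : ∀ e ∈ G.edges, e ⊆ G.verts := fun e he =>
    (Finset.mem_powersetCard.1 (G.edges_sub he)).1
  have hc3 : ∀ e ∈ G.edges, e.card = 3 := fun e he =>
    (Finset.mem_powersetCard.1 (G.edges_sub he)).2
  rcases lt_or_ge l 5 with hl | hl
  -- For l < 4 the upper bound on m is 0; for l = 4 a single edge is already a clique of order 3.
  · have hl4 : l = 4 := by
      by_contra hne
      have : m ≤ 0 := hupp.trans (by interval_cases l <;> simp_all [Nat.choose])
      omega
    subst hl4
    refine absurd ⟨e₀, hc3 e₀ he₀, hsub e₀ he₀, fun e he => ?_⟩ hclique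
    obtain ⟨h1, h2⟩ := Finset.mem_powersetCard.1 he
    rwa [Finset.eq_of_subset_of_card_le h1 (by rw [h2, hc3 e₀ he₀])]
  -- Padding with isolated vertices secures the l vertices that the extremal argument needs.
  set N := max l G.verts.card with hN
  have hN0 : 0 < N := lt_of_lt_of_le (by omega) (le_max_left _ _)
  let ε := G.verts.equivFin
  let φ : α → Fin N := fun a =>
    if h : a ∈ G.verts then Fin.castLE (le_max_right _ _) (ε ⟨a, h⟩) else ⟨0, hN0⟩
  have hφ : Set.InjOn φ G.verts := by
    intro a ha b hb hab
    have ha' : a ∈ G.verts := ha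
    have hb' : b ∈ G.verts := hb
    simp only [φ, dif_pos ha', dif_pos hb'] at hab
    have := ε.injective (Fin.castLE_injective _ hab)
    simpa using this
  have himg : ∀ e ∈ G.edges, ∀ f ⊆ G.verts, f.image φ = e.image φ → f ∈ G.edges := by
    intro e he f hf hfe
    have : f = e := Finset.image_injOn_powerset_of_injOn hφ (by simpa using hf)
      (by simpa using hsub e he) hfe
    rwa [this]
  set E := G.edges.image fun e => e.image φ with hE
  have h3 : ∀ e ∈ E, e.card = 3 := by
    intro f hf
    obtain ⟨e, he, rfl⟩ := Finset.mem_image.1 hf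
    rw [Finset.card_image_of_injOn (hφ.mono (by exact_mod_cast hsub e he)), hc3 e he]
  have hEc : E.card ≤ (l - 1).choose 3 + (l - 2).choose 2 :=
    Finset.card_image_le.trans (hcard.le.trans hupp)
  have hnoclique : ¬ ∃ T : Finset (Fin N), T.card = l - 1 ∧ T.powersetCard 3 ⊆ E := by
    rintro ⟨T, hT, hTE⟩
    -- As l - 1 ≥ 3, each vertex of `T` lies in a triple of `T`, hence in the image of an edge; so
    -- `T` avoids the padding.
    have hTimg : T ⊆ G.verts.image φ := by
      intro t ht
      obtain ⟨s, hts, hsT, hs⟩ := Finset.exists_subsuperset_card_eq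
        (Finset.singleton_subset_iff.2 ht) (by simp : ({t} : Finset (Fin N)).card ≤ 3)
        (by omega : 3 ≤ T.card)
      obtain ⟨e, he, rfl⟩ := Finset.mem_image.1 (hTE (Finset.mem_powersetCard.2 ⟨hsT, hs⟩))
      exact Finset.image_subset_image (hsub e he) (Finset.singleton_subset_iff.1 hts)
    have himgT : (G.verts.filter fun a => φ a ∈ T).image φ = T := by
      ext t
      simp only [Finset.mem_image, Finset.mem_filter]
      constructor
      · rintro ⟨a, ⟨-, ha⟩, rfl⟩; exact ha
      · intro ht
        obtain ⟨a, ha, rfl⟩ := Finset.mem_image.1 (hTimg ht)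
        exact ⟨a, ⟨ha, ht⟩, rfl⟩
    have hfs : G.verts.filter (fun a => φ a ∈ T) ⊆ G.verts := Finset.filter_subset _ _
    refine hclique ⟨G.verts.filter fun a => φ a ∈ T, ?_, hfs, fun f hf => ?_⟩
    · rw [← hT, ← Finset.card_image_of_injOn (hφ.mono (by exact_mod_cast hfs)), himgT]
    · obtain ⟨hf1, hf2⟩ := Finset.mem_powersetCard.1 hf
      have hmem : f.image φ ∈ E := hTE (Finset.mem_powersetCard.2
        ⟨himgT ▸ Finset.image_subset_image hf1, by
          rw [Finset.card_image_of_injOn (hφ.mono (by exact_mod_cast hf1.trans hfs)), hf2]⟩)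
      obtain ⟨e, he, hef⟩ := Finset.mem_image.1 hmem
      exact himg e he f (hf1.trans hfs) hef.symm
  have hlt : ∀ x ∈ stdSimplex ℝ (Fin N),
      TripleSystem.wt E x < (RGraph.initial 3 (l - 1)).lagrangian := fun x hx =>
    TripleSystem.wt_lt_of_no_clique hl hcheck (by simp [hN]) h3 hEc hnoclique hx
  obtain ⟨x₀, hx₀, hmax⟩ := (isCompact_stdSimplex ℝ (Fin N)).exists_isMaxOn
    ⟨_, single_mem_stdSimplex ℝ ⟨0, hN0⟩⟩ (TripleSystem.continuous_wt E).continuousOn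
  refine (TripleSystem.lagrangian_le_of_relabel G hφ ?_ hmax).trans_lt (hlt x₀ hx₀)
  exact Finset.sum_nonneg fun _ _ => Finset.prod_nonneg fun i _ => hx₀.1 i
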